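/- Let $d\ge 2$ be an integer and $q\ge 2$ a real number. For a unit vector $|\phi\rangle\in\mathbb C^d\otimes\mathbb C^d$ with reduced state $\rho_A=\mathrm{tr}_B|\phi\rangle\langle\phi|$ put $$C^t_q(|\phi\rangle)=1-\mathrm{tr}\,\rho_A^q+\mathrm{tr}(I-\rho_A)-\mathrm{tr}(I-\rho_A)^q,\qquad \mathcal C^t_q(|\phi\rangle)=\tfrac1\mu C^t_q(|\phi\rangle),\qquad \mu=d-d^{1-q}\bigl(1+(d-1)^q\bigr),$$ and for a mixed state let $\mathcal C^t_q(\rho)=\inf\sum_i p_i\,\mathcal C^t_q(|\phi_i\rangle)$, the infimum being over all finite decompositions $\rho=\sum_i p_i|\phi_i\rangle\langle\phi_i|$ into pure states ($p_i\ge0$, $\sum_i p_i=1$). For $0\le w\le1$ let $$\varrho_w=\frac{2(1-w)}{d(d+1)}\Bigl(\sum_{i}|ii\rangle\langle ii|+\sum_{l<k}|\Phi^+_{lk}\rangle\langle\Phi^+_{lk}|\Bigr)+\frac{2w}{d(d-1)}\sum_{l<k}|\Phi^-_{lk}\rangle\langle\Phi^-_{lk}|,\qquad |\Phi^\pm_{lk}\rangle=\frac{|lk\rangle\pm|kl\rangle}{\sqrt2},$$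 be the Werner states. Let $\mathbf P\varrho=\int (U\otimes U)\varrho(U\otimes U)^\dagger\,dU$ (normalized Haar measure on the unitary group $U(d)$), let $\mathbf P\mathcal S$ be the set of all $\mathbf P\varrho$ with $\varrho$ a density matrix, and for $\varrho\in\mathbf P\mathcal S$ let $$\zeta(\varrho)=\min\{C^t_q(|\phi\rangle): |\phi\rangle \text{ a unit vector},\ \mathbf P|\phi\rangle\langle\phi|=\varrho\}.$$ By the convex hull of a function on a convex set we mean the largest convex function bounded above by it. Then: 1. $\mathbf P\mathcal S=\{\varrho_w: 0\le w\le 1\}$. The minimum defining $\zeta(\varrho_w)$ is attained for every $w\in[0,1]$; for $\tfrac12<w\le1$, $$\zeta(\varrho_w)=2\Bigl[1-\Bigl(\frac{1+G}2\Bigr)^q-\Bigl(\frac{1-G}2\Bigr)^q\Bigr],\qquad G=2\sqrt{w(1-w)},$$ and $\zeta(\varrho_w)=0$ for $0\le w\le\tfrac12$. 2. On $\mathbf P\mathcal S$ the function $\mathcal C^t_q$ is the convex hull of $\tfrac1\mu\zeta$. Consequently $w\mapsto\mathcal C^t_q(\varrho_w)$ is the convex hull on $[0,1]$ of the function equal to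 $0$ for $w\le\frac12$ and to $\frac2\mu\bigl[1-(\frac{1+G}2)^q-(\frac{1-G}2)^q\bigr]$ for $w>\frac12$. 3. $\mathcal C^t_q(\varrho_w)=0$ for $0\le w\le\tfrac12$. 4. For $d=2$ and $q=3$, $\mathcal C^t_3(\varrho_w)=(2w-1)^2$ for $\tfrac12<w\le1$. -/

import Mathlib

open scoped Kronecker Matrix ComplexOrder

noncomputable section

namespace WernerState

/-- Vectors of the bipartite space `ℂ^d ⊗ ℂ^d`, in the product basis `|ij⟩`. -/
abbrev BiVec (d : ℕ) := EuclideanSpace ℂ (Fin d × Fin d)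

/-- Operators on `ℂ^d ⊗ ℂ^d`. -/
abbrev BiMat (d : ℕ) := Matrix (Fin d × Fin d) (Fin d × Fin d) ℂ

/-- The operator `|φ⟩⟨φ|`. -/
def ketBra {d : ℕ} (φ : BiVec d) : BiMat d :=
  Matrix.of fun i j => φ i * star (φ j)

/-- Density matrices: positive semidefinite of trace one. -/
def IsState {d : ℕ} (ρ : BiMat d) : Prop :=
  ρ.PosSemidef ∧ ρ.trace = 1

/-- The partial trace over the second factor. -/
def partialTraceB {d : ℕ} (ρ : BiMat d) : Matrix (Fin d) (Fin d) ℂ :=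
  Matrix.of fun i k => ∑ j, ρ (i, j) (k, j)

/-- The real power `A ^ q` of a positive semidefinite matrix, by functional calculus. -/
def matPow {d : ℕ} (A : Matrix (Fin d) (Fin d) ℂ) (q : ℝ) : Matrix (Fin d) (Fin d) ℂ :=
  cfc (fun x : ℝ => x ^ q) A

/-- `1 - tr ρ^q + tr (I - ρ) - tr (I - ρ)^q`. -/
def totalF {d : ℕ} (q : ℝ) (ρ : Matrix (Fin d) (Fin d) ℂ) : ℝ :=
  1 - (matPow ρ q).trace.re + (1 - ρ).trace.re - (matPow (1 - ρ) q).trace.re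

/-- The (unnormalized) total concurrence of a pure state. -/
def totalConcurrence {d : ℕ} (q : ℝ) (φ : BiVec d) : ℝ :=
  totalF q (partialTraceB (ketBra φ))

/-- The normalization factor, the value of the total concurrence at maximally entangled states. -/
def normFactor (d : ℕ) (q : ℝ) : ℝ :=
  (d : ℝ) - (d : ℝ) ^ (1 - q) * (1 + ((d : ℝ) - 1) ^ q)

/-- The normalized concurrence of a pure state. -/
def normConcurrencePure {d : ℕ} (q : ℝ) (φ : BiVec d) : ℝ :=
  (1 / normFactor d q) * totalConcurrence q φ

/-- The convex-roof extension of a function of pure states: the infimum of the averages over all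
decompositions into pure states. -/
def convexRoof {d : ℕ} (E : BiVec d → ℝ) (ρ : BiMat d) : ℝ :=
  sInf {x : ℝ | ∃ (n : ℕ) (p : Fin n → ℝ) (φ : Fin n → BiVec d),
    (∀ i, 0 ≤ p i) ∧ ∑ i, p i = 1 ∧ (∀ i, ‖φ i‖ = 1) ∧
    ∑ i, (p i : ℂ) • ketBra (φ i) = ρ ∧ x = ∑ i, p i * E (φ i)}

/-- The `C^t_q`-concurrence of a mixed state. -/
def normConcurrence {d : ℕ} (q : ℝ) (ρ : BiMat d) : ℝ :=
  convexRoof (normConcurrencePure q) ρ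

/-- The product basis vector `|ij⟩`. -/
def ket {d : ℕ} (i j : Fin d) : BiVec d :=
  EuclideanSpace.single (i, j) 1

/-- `(|lk⟩ + |kl⟩) / √2`. -/
def symKet {d : ℕ} (l k : Fin d) : BiVec d :=
  ((1 / Real.sqrt 2 : ℝ) : ℂ) • (ket l k + ket k l)

/-- `(|lk⟩ - |kl⟩) / √2`. -/
def antiKet {d : ℕ} (l k : Fin d) : BiVec d :=
  ((1 / Real.sqrt 2 : ℝ) : ℂ) • (ket l k - ket k l)

/-- The Werner state with weight `w` on the antisymmetric subspace. -/
def werner (d : ℕ) (w : ℝ) : BiMat d :=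
  ((2 * (1 - w) / ((d : ℝ) * ((d : ℝ) + 1)) : ℝ) : ℂ) •
      (∑ i, ketBra (ket i i) + ∑ k, ∑ l ∈ Finset.Iio k, ketBra (symKet l k)) +
    ((2 * w / ((d : ℝ) * ((d : ℝ) - 1)) : ℝ) : ℂ) •
      ∑ k, ∑ l ∈ Finset.Iio k, ketBra (antiKet l k)

/-- The group `U(d)`. -/
abbrev U (d : ℕ) := Matrix.unitaryGroup (Fin d) ℂ

instance (d : ℕ) : MeasurableSpace (U d) := borel _

instance (d : ℕ) : BorelSpace (U d) := ⟨rfl⟩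

instance (d : ℕ) : CompactSpace (U d) := by
  have hK : IsCompact (Set.univ.pi fun _ : Fin d => Set.univ.pi fun _ : Fin d =>
      Metric.closedBall (0 : ℂ) 1) :=
    isCompact_univ_pi fun _ => isCompact_univ_pi fun _ => isCompact_closedBall _ _
  have hc : IsClosed ((Matrix.unitaryGroup (Fin d) ℂ : Set (Matrix (Fin d) (Fin d) ℂ))) :=
    isClosed_unitary
  refine isCompact_iff_compactSpace.mp (hK.of_isClosed_subset hc ?_)
  intro V hV i _ j _
  simpa using entry_norm_bound_of_unitary hV i j

/-- The Haar probability measure of `U(d)`. -/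
def haarU (d : ℕ) : MeasureTheory.Measure (U d) :=
  MeasureTheory.Measure.haarMeasure ⊤

/-- The twirl `ρ ↦ ∫ (V ⊗ V) ρ (V ⊗ V)† dV`, integrated entry by entry. -/
def twirl {d : ℕ} (ρ : BiMat d) : BiMat d :=
  Matrix.of fun i j =>
    ∫ V : U d, (((V : Matrix (Fin d) (Fin d) ℂ) ⊗ₖ (V : Matrix (Fin d) (Fin d) ℂ)) * ρ *
      ((V : Matrix (Fin d) (Fin d) ℂ) ⊗ₖ (V : Matrix (Fin d) (Fin d) ℂ))ᴴ) i j ∂(haarU d)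

/-- The set of all twirled states. -/
def twirledStates (d : ℕ) : Set (BiMat d) :=
  twirl '' {ρ | IsState ρ}

/-- The values of `E` on the pure states whose twirl is `ρ`. -/
def pureValues {d : ℕ} (E : BiVec d → ℝ) (ρ : BiMat d) : Set ℝ :=
  {x | ∃ φ : BiVec d, ‖φ‖ = 1 ∧ twirl (ketBra φ) = ρ ∧ x = E φ}

/-- The symmetry-reduced function `ζ` of `E`. -/
def symmetryReduced {d : ℕ} (E : BiVec d → ℝ) (ρ : BiMat d) : ℝ :=
  sInf (pureValues E ρ)

/-- `g` is the convex hull of `f` on `s`: the largest convex function on `s` bounded above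
by `f`. -/
def IsConvexHullOn {X : Type*} [AddCommGroup X] [Module ℝ X] (s : Set X) (f g : X → ℝ) : Prop :=
  ConvexOn ℝ s g ∧ (∀ x ∈ s, g x ≤ f x) ∧
    ∀ k : X → ℝ, ConvexOn ℝ s k → (∀ x ∈ s, k x ≤ f x) → ∀ x ∈ s, k x ≤ g x

/-- The function `2 [1 - ((1 + G) / 2)^q - ((1 - G) / 2)^q]` with `G = 2 √(w (1 - w))`. -/
def wernerZeta (q w : ℝ) : ℝ :=
  2 * (1 - ((1 + 2 * Real.sqrt (w * (1 - w))) / 2) ^ q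
    - ((1 - 2 * Real.sqrt (w * (1 - w))) / 2) ^ q)

end WernerState

end

noncomputable section

namespace WernerState

/-! Write `h = eigenTerm q` and let `F` be the swap. If `l i` are the eigenvalues of the reduced
state, the total concurrence is `∑ i, h (l i)`, where `h` is concave on `[0, 1]`, symmetric about
`1/2`, and zero at both ends.

By `commutant_eq`, an operator commuting with all `V ⊗ V` is a combination of `1` and `F`. A twirled
state is therefore fixed by its trace and by `tr (F ρ)`, so it is the Werner state of weight `(1 -
tr (F ρ)) / 2`. Computing `ζ` thus means minimizing `∑ i, h (l i)` over unit vectors with `⟨F⟩ = 1 -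
2 w`.

For `w ≤ 1/2` a product vector gives zero. For `w > 1/2`, rotate the reduced state to diagonal form.
If some eigenvalue `x` is at least `1/2`, `neg_swapExp_le` gives `2 w - 1 ≤ 2 √(x (1 - x))`, hence
`x ≤ (1 + G) / 2`. Subadditivity of `h` merges the other eigenvalues into `1 - x`, so the sum is at
least `2 h x ≥ 2 h ((1 + G) / 2)`. If all eigenvalues are below `1/2`, concavity already gives `2 h
(1/2)`, the larger bound. Vectors of Schmidt rank at most two attain the minimum.

For the convex roof, the twirl of a minimizer is a finite mixture of its rotated copies, all of
equal concurrence, so the roof lies below `ζ / μ`. Conversely, the pure states of any decomposition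
of a Werner state have weights averaging to `w`, so Jensen's inequality bounds every convex minorant
of `ζ / μ` by the roof. -/

/-! ### The concave function of one eigenvalue -/

/-- The contribution `1 - x ^ q - (1 - x) ^ q` of an eigenvalue `x` to the total concurrence. -/
def eigenTerm (q x : ℝ) : ℝ := 1 - x ^ q - (1 - x) ^ q

lemma eigenTerm_zero {q : ℝ} (hq : 2 ≤ q) : eigenTerm q 0 = 0 := by
  have : q ≠ 0 := by linarith
  simp [eigenTerm, Real.zero_rpow this]

lemma eigenTerm_one {q : ℝ} (hq : 2 ≤ q) : eigenTerm q 1 = 0 := by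
  have : q ≠ 0 := by linarith
  simp [eigenTerm, Real.zero_rpow this]

lemma eigenTerm_symm (q x : ℝ) : eigenTerm q (1 - x) = eigenTerm q x := by
  simp only [eigenTerm, sub_sub_cancel]; ring

lemma concaveOn_eigenTerm {q : ℝ} (hq : 2 ≤ q) :
    ConcaveOn ℝ (Set.Icc 0 1) (eigenTerm q) := by
  have h1 : ConvexOn ℝ (Set.Icc (0 : ℝ) 1) fun x => x ^ q :=
    (convexOn_rpow (by linarith : 1 ≤ q)).subset (fun x hx => hx.1) (convex_Icc _ _)
  refine ⟨convex_Icc _ _, fun x hx y hy a b ha hb hab => ?_⟩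
  have e1 := h1.2 hx hy ha hb hab
  have e2 := h1.2 (x := 1 - x) (y := 1 - y) ⟨by linarith [hx.2], by linarith [hx.1]⟩
    ⟨by linarith [hy.2], by linarith [hy.1]⟩ ha hb hab
  simp only [smul_eq_mul, eigenTerm] at *
  have : a * (1 - x) + b * (1 - y) = 1 - (a * x + b * y) := by linear_combination hab
  rw [this] at e2
  nlinarith

lemma eigenTerm_nonneg {q x : ℝ} (hq : 2 ≤ q) (hx : x ∈ Set.Icc (0 : ℝ) 1) :
    0 ≤ eigenTerm q x := by
  have := (concaveOn_eigenTerm hq).min_le_of_mem_Icc (x := 0) (y := 1) (by simp) (by simp) hx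
  simpa [eigenTerm_zero hq, eigenTerm_one hq] using this

/-- A point `x` of `[1/2, y]` lies between `1 - y` and `y`, where the values agree by symmetry; a
concave function is there at least the common end value. -/
lemma eigenTerm_antitoneOn {q : ℝ} (hq : 2 ≤ q) :
    AntitoneOn (eigenTerm q) (Set.Icc (1 / 2) 1) := by
  intro x hx y hy hxy
  have := (concaveOn_eigenTerm hq).min_le_of_mem_Icc (x := 1 - y) (y := y) (z := x)
    ⟨by linarith [hy.2], by linarith [hy.1]⟩ ⟨by linarith [hy.1], hy.2⟩
    ⟨by linarith [hx.1], hxy⟩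
  simpa [eigenTerm_symm] using this

lemma eigenTerm_le_half {q x : ℝ} (hq : 2 ≤ q) (hx : x ∈ Set.Icc (0 : ℝ) 1) :
    eigenTerm q x ≤ eigenTerm q (1 / 2) := by
  rcases le_total (1 / 2) x with h | h
  · exact eigenTerm_antitoneOn hq ⟨le_rfl, by norm_num⟩ ⟨h, hx.2⟩ h
  · rw [← eigenTerm_symm q x]
    exact eigenTerm_antitoneOn hq ⟨le_rfl, by norm_num⟩
      ⟨by linarith, by linarith [hx.1]⟩ (by linarith)

/-- By concavity the graph lies above the chord from the origin to the point over `S`. -/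
lemma eigenTerm_chord {q x S : ℝ} (hq : 2 ≤ q) (hS : S ∈ Set.Ioc (0 : ℝ) 1)
    (hx : x ∈ Set.Icc 0 S) : x / S * eigenTerm q S ≤ eigenTerm q x := by
  have h0 : 0 ≤ x / S := div_nonneg hx.1 hS.1.le
  have h1 : x / S ≤ 1 := (div_le_one hS.1).2 hx.2
  have := (concaveOn_eigenTerm hq).2 (x := S) (y := 0) ⟨hS.1.le, hS.2⟩ (by simp) h0
    (sub_nonneg.2 h1) (by ring)
  simpa [eigenTerm_zero hq, div_mul_cancel₀ _ hS.1.ne'] using this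

lemma sum_eigenTerm_ge {ι : Type*} (s : Finset ι) {q S : ℝ} (hq : 2 ≤ q)
    (hS : S ∈ Set.Ioc (0 : ℝ) 1) (x : ι → ℝ) (hx : ∀ i ∈ s, x i ∈ Set.Icc 0 S) :
    (∑ i ∈ s, x i) / S * eigenTerm q S ≤ ∑ i ∈ s, eigenTerm q (x i) := by
  rw [Finset.sum_div, Finset.sum_mul]
  exact Finset.sum_le_sum fun i hi => eigenTerm_chord hq hS (hx i hi)

/-- Subadditivity: the chord bounds taken with `S` equal to the total. A zero total has no chord and
is treated apart. -/
lemma eigenTerm_sum_le {ι : Type*} (s : Finset ι) {q : ℝ} (hq : 2 ≤ q)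
    (x : ι → ℝ) (hx : ∀ i ∈ s, 0 ≤ x i) (h1 : ∑ i ∈ s, x i ≤ 1) :
    eigenTerm q (∑ i ∈ s, x i) ≤ ∑ i ∈ s, eigenTerm q (x i) := by
  have hle : ∀ i ∈ s, x i ≤ ∑ i ∈ s, x i := fun i hi => Finset.single_le_sum hx hi
  rcases (Finset.sum_nonneg hx).eq_or_lt with h | h
  · rw [← h, eigenTerm_zero hq]
    exact Finset.sum_nonneg fun i hi =>
      eigenTerm_nonneg hq ⟨hx i hi, (hle i hi).trans h1⟩
  · have := sum_eigenTerm_ge s hq ⟨h, h1⟩ x fun i hi => ⟨hx i hi, hle i hi⟩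
    rwa [div_self h.ne', one_mul] at this

lemma two_mul_eigenTerm_half_le {ι : Type*} [Fintype ι] {q : ℝ} (hq : 2 ≤ q)
    (x : ι → ℝ) (hx : ∀ i, x i ∈ Set.Icc 0 (1 / 2)) (h1 : ∑ i, x i = 1) :
    2 * eigenTerm q (1 / 2) ≤ ∑ i, eigenTerm q (x i) := by
  have := sum_eigenTerm_ge Finset.univ hq (S := 1 / 2) (by norm_num) x fun i _ => hx i
  rw [h1] at this
  linarith

/-- By subadditivity the eigenvalues other than `x i` contribute at least as much as the single
eigenvalue `1 - x i`, and by symmetry that equals the contribution of `x i`. -/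
lemma two_mul_eigenTerm_le {ι : Type*} [Fintype ι] [DecidableEq ι] {q : ℝ} (hq : 2 ≤ q)
    (x : ι → ℝ) (hx : ∀ i, 0 ≤ x i) (h1 : ∑ i, x i = 1) (i : ι) :
    2 * eigenTerm q (x i) ≤ ∑ j, eigenTerm q (x j) := by
  have e : x i + ∑ j ∈ Finset.univ.erase i, x j = 1 :=
    (Finset.add_sum_erase _ x (Finset.mem_univ i)).trans h1
  have := eigenTerm_sum_le (Finset.univ.erase i) hq x (fun j _ => hx j) (by linarith [hx i])
  rw [← Finset.add_sum_erase _ (fun j => eigenTerm q (x j)) (Finset.mem_univ i)]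
  rw [show ∑ j ∈ Finset.univ.erase i, x j = 1 - x i by linarith, eigenTerm_symm] at this
  linarith

lemma eigenTerm_pos {q x : ℝ} (hq : 2 ≤ q) (hx : x ∈ Set.Ioo (0 : ℝ) 1) :
    0 < eigenTerm q x := by
  have h1 := Real.rpow_lt_rpow_of_exponent_gt hx.1 hx.2 (show (1 : ℝ) < q by linarith)
  have h2 := Real.rpow_lt_rpow_of_exponent_gt (x := 1 - x) (by linarith [hx.2])
    (by linarith [hx.1]) (show (1 : ℝ) < q by linarith)
  rw [Real.rpow_one] at h1 h2
  simp only [eigenTerm]; linarith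

lemma normFactor_eq {d : ℕ} (hd : 2 ≤ d) (q : ℝ) :
    normFactor d q = d * eigenTerm q (1 / d) := by
  have hd' : (2 : ℝ) ≤ d := by exact_mod_cast hd
  have h0 : (0 : ℝ) < d := by linarith
  rw [normFactor, eigenTerm, show 1 - 1 / (d : ℝ) = ((d : ℝ) - 1) / d by field_simp,
    Real.div_rpow zero_le_one h0.le, Real.div_rpow (by linarith) h0.le, Real.one_rpow,
    Real.rpow_sub h0, Real.rpow_one]
  ring

lemma normFactor_pos {d : ℕ} (hd : 2 ≤ d) {q : ℝ} (hq : 2 ≤ q) : 0 < normFactor d q := by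
  have hd' : (2 : ℝ) ≤ d := by exact_mod_cast hd
  rw [normFactor_eq hd]
  refine mul_pos (by linarith) (eigenTerm_pos hq ⟨by positivity, ?_⟩)
  rw [div_lt_one (by linarith)]; linarith

lemma wernerZeta_eq (q w : ℝ) :
    wernerZeta q w = 2 * eigenTerm q ((1 + 2 * √(w * (1 - w))) / 2) := by
  rw [wernerZeta, eigenTerm,
    show 1 - (1 + 2 * √(w * (1 - w))) / 2 = (1 - 2 * √(w * (1 - w))) / 2 by ring]

/-! ### Total concurrence as a spectral sum of the reduced state -/

lemma trace_cfc_eq_sum {n : Type*} [Fintype n] [DecidableEq n] {A : Matrix n n ℂ}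
    (hA : A.IsHermitian) (f : ℝ → ℝ) :
    (cfc f A).trace = ((∑ i, f (hA.eigenvalues i) : ℝ) : ℂ) := by
  rw [hA.cfc_eq, Matrix.IsHermitian.cfc, Unitary.conjStarAlgAut_apply, Matrix.trace_mul_cycle]
  simp [Matrix.trace_diagonal]

/-- Written through the characteristic polynomial, the trace is visibly invariant under conjugation
and needs no matching of eigenvalue orderings. -/
lemma trace_cfc_eq_roots {n : Type*} [Fintype n] [DecidableEq n] {A : Matrix n n ℂ}
    (hA : A.IsHermitian) (f : ℝ → ℝ) :
    (cfc f A).trace.re = (A.charpoly.roots.map fun z : ℂ => f z.re).sum := by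
  rw [trace_cfc_eq_sum hA, hA.roots_charpoly_eq_eigenvalues, Complex.ofReal_re]
  simp

/-- Trace one turns the scalar terms into `tr I`, so both matrix powers merge into one functional
calculus of `A`. -/
lemma totalF_eq_trace_cfc {d : ℕ} {q : ℝ} (hq : 2 ≤ q) {A : Matrix (Fin d) (Fin d) ℂ}
    (hA : A.IsHermitian) (h1 : A.trace = 1) :
    totalF q A = (cfc (eigenTerm q) A).trace.re := by
  have hq0 : 0 ≤ q := by linarith
  have hc : Continuous fun x : ℝ => x ^ q := Real.continuous_rpow_const hq0
  have hs : IsSelfAdjoint A := hA.isSelfAdjoint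
  have e : cfc (fun x : ℝ => (1 - x) ^ q) A = cfc (fun x : ℝ => x ^ q) (1 - A) := by
    rw [cfc_comp' (fun x : ℝ => x ^ q) (fun x : ℝ => 1 - x) A (hc.continuousOn)]
    rw [cfc_sub (R := ℝ) (fun _ => 1) (fun x => x) A, cfc_const_one ℝ A, cfc_id' ℝ A]
  have h : cfc (eigenTerm q) A = 1 - matPow A q - matPow (1 - A) q := by
    rw [matPow, matPow, ← e]
    unfold eigenTerm
    have c2 : Continuous fun x : ℝ => (1 - x) ^ q := hc.comp (by fun_prop)
    rw [cfc_sub (R := ℝ) (fun x => 1 - x ^ q) (fun x => (1 - x) ^ q) A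
      (by fun_prop) (by fun_prop), cfc_sub (R := ℝ) (fun _ => 1) (fun x => x ^ q) A
      (by fun_prop) (by fun_prop), cfc_const_one ℝ A]
  rw [h, totalF]
  simp only [Matrix.trace_sub, h1, Matrix.trace_one, Complex.sub_re, Complex.one_re]
  ring

/-- The coefficient matrix of a bipartite vector. -/
def coeffMat {d : ℕ} (φ : BiVec d) : Matrix (Fin d) (Fin d) ℂ := Matrix.of fun i j => φ (i, j)

/-- The bipartite vector with a given coefficient matrix. -/
def vecOf {d : ℕ} (A : Matrix (Fin d) (Fin d) ℂ) : BiVec d :=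
  WithLp.toLp 2 fun i => A i.1 i.2

@[simp] lemma vecOf_apply {d : ℕ} (A : Matrix (Fin d) (Fin d) ℂ) (i : Fin d × Fin d) :
    vecOf A i = A i.1 i.2 := rfl

@[simp] lemma coeffMat_vecOf {d : ℕ} (A : Matrix (Fin d) (Fin d) ℂ) : coeffMat (vecOf A) = A := rfl

lemma partialTraceB_ketBra {d : ℕ} (φ : BiVec d) :
    partialTraceB (ketBra φ) = coeffMat φ * (coeffMat φ)ᴴ := by
  ext i k
  simp [partialTraceB, ketBra, coeffMat, Matrix.mul_apply]

lemma norm_sq_eq_sum {d : ℕ} (φ : BiVec d) :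
    ‖φ‖ ^ 2 = ∑ i, ∑ j, ‖coeffMat φ i j‖ ^ 2 := by
  rw [EuclideanSpace.norm_sq_eq, Fintype.sum_prod_type]; rfl

lemma mul_conjTranspose_apply_self {n : Type*} [Fintype n] (A : Matrix n n ℂ) (i : n) :
    (A * Aᴴ) i i = ((∑ j, ‖A i j‖ ^ 2 : ℝ) : ℂ) := by
  simp [Matrix.mul_apply, Complex.mul_conj, Complex.normSq_eq_norm_sq]

lemma trace_coeffMat_mul {d : ℕ} (φ : BiVec d) :
    (coeffMat φ * (coeffMat φ)ᴴ).trace = ((‖φ‖ ^ 2 : ℝ) : ℂ) := by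
  rw [norm_sq_eq_sum, Matrix.trace]
  simp only [Matrix.diag_apply, mul_conjTranspose_apply_self]
  push_cast; rfl

lemma totalConcurrence_eq_roots {d : ℕ} {q : ℝ} (hq : 2 ≤ q) {φ : BiVec d} (hφ : ‖φ‖ = 1) :
    totalConcurrence q φ = ((coeffMat φ * (coeffMat φ)ᴴ).charpoly.roots.map
      fun z : ℂ => eigenTerm q z.re).sum := by
  have hA : (coeffMat φ * (coeffMat φ)ᴴ).IsHermitian := Matrix.isHermitian_mul_conjTranspose_self _
  rw [totalConcurrence, partialTraceB_ketBra, totalF_eq_trace_cfc hq hA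
    (by rw [trace_coeffMat_mul, hφ]; simp), trace_cfc_eq_roots hA]

lemma totalConcurrence_of_diagonal {d : ℕ} {q : ℝ} (hq : 2 ≤ q) {φ : BiVec d} (hφ : ‖φ‖ = 1)
    {l : Fin d → ℝ}
    (h : coeffMat φ * (coeffMat φ)ᴴ = Matrix.diagonal fun i => (l i : ℂ)) :
    totalConcurrence q φ = ∑ i, eigenTerm q (l i) := by
  rw [totalConcurrence_eq_roots hq hφ, h, Matrix.charpoly_diagonal,
    Polynomial.roots_prod _ _ (Finset.prod_ne_zero_iff.2 fun i _ => Polynomial.X_sub_C_ne_zero _)]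
  simp [Finset.sum, Function.comp_def]

/-! ### Local rotations -/

/-- The local rotation `V ⊗ W` of a bipartite vector, on coefficient matrices. -/
def rotVec {d : ℕ} (V W : U d) (φ : BiVec d) : BiVec d :=
  vecOf ((V : Matrix (Fin d) (Fin d) ℂ) * coeffMat φ * (W : Matrix (Fin d) (Fin d) ℂ)ᵀ)

lemma U_mul_star {d : ℕ} (V : U d) :
    (V : Matrix (Fin d) (Fin d) ℂ) * (V : Matrix (Fin d) (Fin d) ℂ)ᴴ = 1 :=
  Matrix.mem_unitaryGroup_iff.1 V.2

lemma U_star_mul {d : ℕ} (V : U d) :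
    (V : Matrix (Fin d) (Fin d) ℂ)ᴴ * (V : Matrix (Fin d) (Fin d) ℂ) = 1 :=
  Matrix.mem_unitaryGroup_iff'.1 V.2

lemma reduced_rotVec {d : ℕ} (V W : U d) (φ : BiVec d) :
    coeffMat (rotVec V W φ) * (coeffMat (rotVec V W φ))ᴴ =
      (V : Matrix (Fin d) (Fin d) ℂ) * (coeffMat φ * (coeffMat φ)ᴴ) *
        (V : Matrix (Fin d) (Fin d) ℂ)ᴴ := by
  have h : (W : Matrix (Fin d) (Fin d) ℂ)ᵀ * ((W : Matrix (Fin d) (Fin d) ℂ)ᵀ)ᴴ = 1 := by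
    change (W : Matrix (Fin d) (Fin d) ℂ)ᵀ * ((W : Matrix (Fin d) (Fin d) ℂ)ᴴ)ᵀ = 1
    rw [← Matrix.transpose_mul, U_star_mul, Matrix.transpose_one]
  simp only [rotVec, coeffMat_vecOf, Matrix.conjTranspose_mul, Matrix.mul_assoc]
  rw [← Matrix.mul_assoc (W : Matrix (Fin d) (Fin d) ℂ)ᵀ, h, Matrix.one_mul]

lemma norm_rotVec {d : ℕ} (V W : U d) (φ : BiVec d) : ‖rotVec V W φ‖ = ‖φ‖ := by
  have h := congrArg Matrix.trace (reduced_rotVec V W φ)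
  rw [Matrix.trace_mul_cycle, U_star_mul, Matrix.one_mul, trace_coeffMat_mul,
    trace_coeffMat_mul] at h
  exact (sq_eq_sq₀ (norm_nonneg _) (norm_nonneg _)).1 (by exact_mod_cast h)

lemma totalConcurrence_rotVec {d : ℕ} {q : ℝ} (hq : 2 ≤ q) (V W : U d) {φ : BiVec d}
    (hφ : ‖φ‖ = 1) : totalConcurrence q (rotVec V W φ) = totalConcurrence q φ := by
  rw [totalConcurrence_eq_roots hq hφ, totalConcurrence_eq_roots hq (by rwa [norm_rotVec]),
    reduced_rotVec, Matrix.charpoly_mul_comm, ← Matrix.mul_assoc, U_star_mul, Matrix.one_mul]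

/-- A local rotation brings the reduced state of a vector to diagonal form. -/
lemma exists_rotVec_diagonal {d : ℕ} (φ : BiVec d) : ∃ (V : U d) (l : Fin d → ℝ),
    (∀ i, l i = ∑ j, ‖coeffMat (rotVec V V φ) i j‖ ^ 2) ∧
    coeffMat (rotVec V V φ) * (coeffMat (rotVec V V φ))ᴴ =
      Matrix.diagonal fun i => (l i : ℂ) := by
  have hA : (coeffMat φ * (coeffMat φ)ᴴ).IsHermitian := Matrix.isHermitian_mul_conjTranspose_self _
  -- Diagonalizing needs only the rotation of the first factor; the same unitary is used on the
  -- second so that the swap expectation is preserved.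
  have key : coeffMat (rotVec (star hA.eigenvectorUnitary) (star hA.eigenvectorUnitary) φ) *
      (coeffMat (rotVec (star hA.eigenvectorUnitary) (star hA.eigenvectorUnitary) φ))ᴴ =
      Matrix.diagonal fun i => (hA.eigenvalues i : ℂ) := by
    rw [reduced_rotVec]
    have := hA.conjStarAlgAut_star_eigenvectorUnitary
    rw [Unitary.conjStarAlgAut_apply] at this
    exact this
  refine ⟨star hA.eigenvectorUnitary, hA.eigenvalues, fun i => ?_, key⟩
  have := congrFun (congrFun key i) i
  rw [mul_conjTranspose_apply_self, Matrix.diagonal_apply_eq] at this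
  exact_mod_cast this.symm

/-! ### The swap operator and the Werner states -/

/-- The swap operator `|ij⟩ ↦ |ji⟩`. -/
def swapMat (d : ℕ) : BiMat d := Matrix.of fun i j => if i.swap = j then 1 else 0

lemma swapMat_mul_apply {d : ℕ} (M : BiMat d) (i j : Fin d × Fin d) :
    (swapMat d * M) i j = M i.swap j := by
  simp [swapMat, Matrix.mul_apply]

lemma mul_swapMat_apply {d : ℕ} (M : BiMat d) (i j : Fin d × Fin d) :
    (M * swapMat d) i j = M i j.swap := by
  simp [swapMat, Matrix.mul_apply, Prod.swap_eq_iff_eq_swap]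

lemma swapMat_mul_self (d : ℕ) : swapMat d * swapMat d = 1 := by
  ext i j
  rw [swapMat_mul_apply, Matrix.one_apply]
  simp [swapMat]

lemma trace_swapMat (d : ℕ) : (swapMat d).trace = d := by
  simp only [Matrix.trace, Matrix.diag_apply, swapMat, Matrix.of_apply, Fintype.sum_prod_type,
    Prod.swap_prod_mk, Prod.mk.injEq, ite_and]
  simp

lemma swapMat_isHermitian (d : ℕ) : (swapMat d).IsHermitian := by
  ext i j
  have : j.swap = i ↔ i.swap = j := by rw [Prod.swap_eq_iff_eq_swap, eq_comm]
  simp [swapMat, Matrix.conjTranspose_apply, this]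

lemma swapMat_mul_kronecker {d : ℕ} (V : Matrix (Fin d) (Fin d) ℂ) :
    swapMat d * (V ⊗ₖ V) = (V ⊗ₖ V) * swapMat d := by
  ext i j
  rw [swapMat_mul_apply, mul_swapMat_apply]
  simp [mul_comm]

/-- The expectation of the swap in a vector. -/
def swapExp {d : ℕ} (φ : BiVec d) : ℝ :=
  ∑ i, ∑ j, (coeffMat φ i j * star (coeffMat φ j i)).re

lemma trace_swapMat_mul_ketBra {d : ℕ} (φ : BiVec d) :
    (swapMat d * ketBra φ).trace.re = swapExp φ := by
  simp only [Matrix.trace, Matrix.diag_apply, swapMat_mul_apply, Fintype.sum_prod_type,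
    Complex.re_sum, swapExp]
  rw [Finset.sum_comm]
  rfl

lemma ketBra_rotVec {d : ℕ} (V : U d) (φ : BiVec d) :
    ketBra (rotVec V V φ) = ((V : Matrix (Fin d) (Fin d) ℂ) ⊗ₖ (V : Matrix (Fin d) (Fin d) ℂ)) *
      ketBra φ * ((V : Matrix (Fin d) (Fin d) ℂ) ⊗ₖ (V : Matrix (Fin d) (Fin d) ℂ))ᴴ := by
  have hr : (rotVec V V φ : Fin d × Fin d → ℂ) =
      ((V : Matrix (Fin d) (Fin d) ℂ) ⊗ₖ (V : Matrix (Fin d) (Fin d) ℂ)) *ᵥ φ := by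
    ext i
    simp only [rotVec, vecOf_apply, Matrix.mul_apply, Matrix.mulVec, dotProduct,
      Fintype.sum_prod_type, Matrix.kroneckerMap_apply, Matrix.transpose_apply, coeffMat,
      Matrix.of_apply, Finset.sum_mul]
    rw [Finset.sum_comm]
    refine Finset.sum_congr rfl fun _ _ => Finset.sum_congr rfl fun _ _ => by ring
  have hk : ∀ ψ : BiVec d, ketBra ψ = Matrix.vecMulVec (ψ : Fin d × Fin d → ℂ) (star ψ) :=
    fun ψ => rfl
  rw [hk, hk, hr, Matrix.mul_vecMulVec, Matrix.vecMulVec_mul, Matrix.star_mulVec]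

lemma ketBra_posSemidef {d : ℕ} (φ : BiVec d) : (ketBra φ).PosSemidef :=
  Matrix.posSemidef_vecMulVec_self_star (φ : Fin d × Fin d → ℂ)

lemma trace_ketBra {d : ℕ} (φ : BiVec d) : (ketBra φ).trace = ((‖φ‖ ^ 2 : ℝ) : ℂ) := by
  rw [norm_sq_eq_sum, Matrix.trace]
  simp [ketBra, coeffMat, Fintype.sum_prod_type, Complex.mul_conj, Complex.normSq_eq_norm_sq]

lemma isState_ketBra {d : ℕ} {φ : BiVec d} (hφ : ‖φ‖ = 1) : IsState (ketBra φ) :=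
  ⟨ketBra_posSemidef φ, by simp [trace_ketBra, hφ]⟩

/-- Used to turn the sums over pairs `l < k` in the Werner state into full double sums, which are
the identity and the swap. -/
lemma sum_Iio_add_sum_diag {d : ℕ} {M : Type*} [AddCommMonoid M] (f : Fin d → Fin d → M) :
    ∑ i, f i i + ∑ k, ∑ l ∈ Finset.Iio k, (f l k + f k l) = ∑ l, ∑ k, f l k := by
  have h1 : ∀ k : Fin d, ∑ l, f k l =
      f k k + (∑ l ∈ Finset.Iio k, f k l + ∑ l ∈ Finset.Ioi k, f k l) := by
    intro k
    rw [← Finset.add_sum_erase _ _ (Finset.mem_univ k), ← Finset.sum_union]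
    · congr 2
      ext l; simp [lt_or_lt_iff_ne]
    · exact Finset.disjoint_left.2 fun l hl hl' =>
        lt_asymm (Finset.mem_Iio.1 hl) (Finset.mem_Ioi.1 hl')
  have h2 : ∑ k, ∑ l ∈ Finset.Ioi k, f k l = ∑ k, ∑ l ∈ Finset.Iio k, f l k :=
    Finset.sum_comm' (by simp)
  simp only [h1, Finset.sum_add_distrib, h2]
  congr 1
  exact add_comm _ _

lemma sum_ket_ket (d : ℕ) :
    ∑ l : Fin d, ∑ k : Fin d, Matrix.single (l, k) (l, k) (1 : ℂ) = 1 := by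
  rw [← Fintype.sum_prod_type (fun p : Fin d × Fin d => Matrix.single p p (1 : ℂ))]
  ext i j
  simp [Matrix.sum_apply, Matrix.single_apply, Matrix.one_apply, ite_and]

lemma sum_ket_swap (d : ℕ) :
    ∑ l : Fin d, ∑ k : Fin d, Matrix.single (l, k) (k, l) (1 : ℂ) = swapMat d := by
  refine (Fintype.sum_prod_type (fun p : Fin d × Fin d =>
    Matrix.single p p.swap (1 : ℂ))).symm.trans ?_
  ext i j
  simp [Matrix.sum_apply, Matrix.single_apply, swapMat, ite_and]

lemma inv_sqrt_two_mul_self :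
    ((1 / Real.sqrt 2 : ℝ) : ℂ) * ((1 / Real.sqrt 2 : ℝ) : ℂ) = 1 / 2 := by
  rw [← Complex.ofReal_mul, div_mul_div_comm, Real.mul_self_sqrt (by norm_num)]
  norm_num

lemma ketBra_ket {d : ℕ} (l k : Fin d) :
    ketBra (ket l k) = Matrix.single (l, k) (l, k) (1 : ℂ) := by
  ext i j
  rw [Matrix.single_apply]
  simp only [ketBra, ket, Matrix.of_apply, PiLp.single_apply, eq_comm (a := (l, k))]
  split_ifs <;> simp_all

lemma ketBra_smul_add {d : ℕ} (l k : Fin d) (s : ℂ) (hs : star s = s) :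
    ketBra (((1 / Real.sqrt 2 : ℝ) : ℂ) • (ket l k + s • ket k l)) =
      (1 / 2 : ℂ) • (Matrix.single (l, k) (l, k) (1 : ℂ) + s • Matrix.single (l, k) (k, l) (1 : ℂ) +
        ((s * s) • Matrix.single (k, l) (k, l) (1 : ℂ) +
          s • Matrix.single (k, l) (l, k) (1 : ℂ))) := by
  have hs' : (starRingEnd ℂ) s = s := hs
  have h2 : (starRingEnd ℂ) ((1 / Real.sqrt 2 : ℝ) : ℂ) = ((1 / Real.sqrt 2 : ℝ) : ℂ) :=
    Complex.conj_ofReal _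
  have e : ∀ p q i j : Fin d × Fin d, Matrix.single p q (1 : ℂ) i j =
      (if i = p then 1 else 0) * (if j = q then 1 else 0) := by
    intro p q i j
    simp only [Matrix.single_apply, eq_comm (a := p), eq_comm (a := q)]
    split_ifs <;> simp_all
  ext i j
  simp only [ketBra, ket, Matrix.of_apply, PiLp.smul_apply, PiLp.add_apply, smul_eq_mul,
    PiLp.single_apply, Complex.star_def, map_mul, map_add, hs', h2, Matrix.smul_apply,
    Matrix.add_apply, e, ← inv_sqrt_two_mul_self, apply_ite (starRingEnd ℂ), map_one, map_zero]
  ring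

lemma ketBra_symKet {d : ℕ} (l k : Fin d) : ketBra (symKet l k) =
    (1 / 2 : ℂ) • (Matrix.single (l, k) (l, k) (1 : ℂ) + Matrix.single (l, k) (k, l) (1 : ℂ)) +
    (1 / 2 : ℂ) • (Matrix.single (k, l) (k, l) (1 : ℂ) + Matrix.single (k, l) (l, k) (1 : ℂ)) := by
  have := ketBra_smul_add l k 1 (by simp)
  simpa [symKet, smul_add] using this

lemma ketBra_antiKet {d : ℕ} (l k : Fin d) : ketBra (antiKet l k) =
    (1 / 2 : ℂ) • (Matrix.single (l, k) (l, k) (1 : ℂ) - Matrix.single (l, k) (k, l) (1 : ℂ)) +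
    (1 / 2 : ℂ) • (Matrix.single (k, l) (k, l) (1 : ℂ) - Matrix.single (k, l) (l, k) (1 : ℂ)) := by
  have := ketBra_smul_add l k (-1) (by simp)
  simpa [antiKet, smul_add, sub_eq_add_neg] using this

lemma sum_symKet (d : ℕ) :
    ∑ i : Fin d, ketBra (ket i i) + ∑ k : Fin d, ∑ l ∈ Finset.Iio k, ketBra (symKet l k) =
      (1 / 2 : ℂ) • (1 + swapMat d) := by
  have h := sum_Iio_add_sum_diag fun l k : Fin d =>
    (1 / 2 : ℂ) • (Matrix.single (l, k) (l, k) (1 : ℂ) + Matrix.single (l, k) (k, l) (1 : ℂ))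
  simp only [← ketBra_symKet, ← Finset.smul_sum, Finset.sum_add_distrib, sum_ket_ket,
    sum_ket_swap] at h
  rw [← h]
  congr 1
  rw [smul_add, ← add_smul]
  norm_num [ketBra_ket]

lemma sum_antiKet (d : ℕ) :
    ∑ k : Fin d, ∑ l ∈ Finset.Iio k, ketBra (antiKet l k) = (1 / 2 : ℂ) • (1 - swapMat d) := by
  have h := sum_Iio_add_sum_diag fun l k : Fin d =>
    (1 / 2 : ℂ) • (Matrix.single (l, k) (l, k) (1 : ℂ) - Matrix.single (l, k) (k, l) (1 : ℂ))
  simp only [← ketBra_antiKet, ← Finset.smul_sum, Finset.sum_sub_distrib, sum_ket_ket,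
    sum_ket_swap] at h
  rw [← h]
  simp

lemma werner_eq (d : ℕ) (w : ℝ) :
    werner d w = (((1 - w) / (d * (d + 1)) : ℝ) : ℂ) • (1 + swapMat d) +
      ((w / (d * (d - 1)) : ℝ) : ℂ) • (1 - swapMat d) := by
  rw [werner, sum_symKet, sum_antiKet, smul_smul, smul_smul]
  congr 2
  · push_cast; ring
  · push_cast; ring

/-! ### The commutant of the operators `V ⊗ V` -/

/-- `V ⊗ V`. -/
def kronSelf {d : ℕ} (V : U d) : BiMat d :=
  (V : Matrix (Fin d) (Fin d) ℂ) ⊗ₖ (V : Matrix (Fin d) (Fin d) ℂ)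

lemma kronSelf_mul {d : ℕ} (V W : U d) : kronSelf (V * W) = kronSelf V * kronSelf W := by
  simp [kronSelf, Matrix.mul_kronecker_mul]

lemma kronSelf_star_mul {d : ℕ} (V : U d) : (kronSelf V)ᴴ * kronSelf V = 1 := by
  rw [kronSelf, Matrix.conjTranspose_kronecker, ← Matrix.mul_kronecker_mul, U_star_mul,
    Matrix.one_kronecker_one]

/-- The unitary that multiplies the basis vector `m` by the imaginary unit. -/
def phaseU {d : ℕ} (m : Fin d) : U d :=
  ⟨Matrix.diagonal fun i => if i = m then Complex.I else 1, by
    rw [Matrix.mem_unitaryGroup_iff, Matrix.star_eq_conjTranspose,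
      Matrix.diagonal_conjTranspose, Matrix.diagonal_mul_diagonal, ← Matrix.diagonal_one]
    congr 1
    ext i
    by_cases h : i = m <;> simp [h]⟩

/-- The vector `e_l + 2 e_k`. -/
def reflVec {d : ℕ} (l k i : Fin d) : ℂ := (if i = l then 1 else 0) + 2 * if i = k then 1 else 0

lemma sum_reflVec_mul_self {d : ℕ} {l k : Fin d} (h : l ≠ k) :
    ∑ i, reflVec l k i * reflVec l k i = 5 := by
  have e : ∀ i, reflVec l k i * reflVec l k i =
      (if i = l then 1 else 0) + 4 * if i = k then 1 else 0 := by
    intro i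
    by_cases h1 : i = l
    · subst h1; simp [reflVec, h]
    · by_cases h2 : i = k
      · subst h2; norm_num [reflVec, h1]
      · simp [reflVec, h1, h2]
  simp only [e, Finset.sum_add_distrib, ← Finset.mul_sum]
  norm_num

/-- The reflection in the hyperplane orthogonal to `e_l + 2 e_k`. -/
def reflU {d : ℕ} (l k : Fin d) (h : l ≠ k) : U d :=
  -- The vector has squared norm 5, hence the factor `2 / 5`. On the span of `e_l` and `e_k` the
  -- entries are `3/5`, `-4/5` and `-3/5`: rational, and none vanishes.
  ⟨Matrix.of fun i j => (if i = j then 1 else 0) - 2 / 5 * (reflVec l k i * reflVec l k j), by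
    have hr : ∀ i, (starRingEnd ℂ) (reflVec l k i) = reflVec l k i := by
      intro i; simp [reflVec, apply_ite (starRingEnd ℂ), map_ofNat]
    rw [Matrix.mem_unitaryGroup_iff]
    ext i j
    simp only [Matrix.mul_apply, Matrix.star_apply, Matrix.of_apply, star_sub, star_mul',
      Complex.star_def, map_div₀, hr, apply_ite (starRingEnd ℂ), map_one, map_zero, map_ofNat,
      Matrix.one_apply]
    have e : ∀ x, ((if i = x then (1 : ℂ) else 0) - 2 / 5 * (reflVec l k i * reflVec l k x)) *
        ((if j = x then 1 else 0) - 2 / 5 * (reflVec l k j * reflVec l k x)) =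
        (if i = x then (if j = x then 1 else 0) else 0) -
        (if i = x then 2 / 5 * (reflVec l k j * reflVec l k x) else 0) -
        (if j = x then 2 / 5 * (reflVec l k i * reflVec l k x) else 0) +
        4 / 25 * reflVec l k i * reflVec l k j * (reflVec l k x * reflVec l k x) := by
      intro x; split_ifs <;> ring
    simp only [e, Finset.sum_add_distrib, Finset.sum_sub_distrib, ← Finset.mul_sum,
      sum_reflVec_mul_self h, Finset.sum_ite_eq, Finset.mem_univ, if_true, eq_comm (a := j) (b := i)]
    ring⟩

section Commutant

variable {d : ℕ} {X : BiMat d}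

/-- Commuting with the diagonal unitary `phaseU m` forces a nonzero entry to join index pairs in
which `m` occurs equally often, because `1`, `I`, `-1` are distinct. For all `m` together this means
equal pairs up to order. -/
lemma commutant_support (hX : ∀ V : U d, kronSelf V * X = X * kronSelf V)
    {i j : Fin d × Fin d} (h1 : j ≠ i) (h2 : j ≠ i.swap) : X i j = 0 := by
  have key : ∀ m : Fin d, X i j ≠ 0 →
      (if i.1 = m then Complex.I else 1) * (if i.2 = m then Complex.I else 1) =
      (if j.1 = m then Complex.I else 1) * (if j.2 = m then Complex.I else 1) := by
    intro m h0
    have hk : kronSelf (phaseU m) = Matrix.diagonal fun i : Fin d × Fin d =>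
        (if i.1 = m then Complex.I else 1) * (if i.2 = m then Complex.I else 1) := by
      simp [kronSelf, phaseU, Matrix.diagonal_kronecker_diagonal]
    have h := congrFun (congrFun (hX (phaseU m)) i) j
    rw [hk, Matrix.diagonal_mul, Matrix.mul_diagonal, mul_comm] at h
    exact mul_left_cancel₀ h0 h
  by_contra h0
  obtain ⟨a, b⟩ := i
  obtain ⟨c, e⟩ := j
  have ha := key a h0
  have hb := key b h0
  have n1 : (Complex.I : ℂ) ≠ 1 := fun h => by simpa using congrArg Complex.im h
  have n2 : (-1 : ℂ) ≠ 1 := by norm_num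
  have n3 : (Complex.I : ℂ) ≠ -1 := fun h => by simpa using congrArg Complex.im h
  simp only [ne_eq, Prod.mk.injEq, Prod.swap_prod_mk, not_and] at h1 h2
  by_cases hab : b = a
  · subst hab
    by_cases hc : c = b <;> by_cases he : e = b <;> simp_all
  · by_cases hc : c = a <;> by_cases he : e = a <;> by_cases hc' : c = b <;>
      by_cases he' : e = b <;> simp_all

lemma commutant_mul_apply (hX : ∀ V : U d, kronSelf V * X = X * kronSelf V) (T : BiMat d)
    (i j : Fin d × Fin d) : (X * T) i j =
      if i.1 = i.2 then X i i * T i j else X i i * T i j + X i i.swap * T i.swap j := by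
  have h0 : ∀ m, m ≠ i → m ≠ i.swap → X i m * T m j = 0 := fun m h1 h2 => by
    rw [commutant_support hX h1 h2, zero_mul]
  rw [Matrix.mul_apply]
  split_ifs with h
  · refine Finset.sum_eq_single i (fun m _ hm => h0 m hm ?_) (by simp)
    rwa [show i.swap = i from Prod.ext h.symm h]
  · exact Finset.sum_eq_add i i.swap (fun hi => h (congrArg Prod.fst hi))
      (fun m _ hm => h0 m hm.1 hm.2) (by simp) (by simp)

lemma commutant_apply_mul (hX : ∀ V : U d, kronSelf V * X = X * kronSelf V) (T : BiMat d)
    (i j : Fin d × Fin d) : (T * X) i j =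
      if j.1 = j.2 then T i j * X j j else T i j * X j j + T i j.swap * X j.swap j := by
  have h0 : ∀ m, m ≠ j → m ≠ j.swap → T i m * X m j = 0 := fun m h1 h2 => by
    rw [commutant_support hX h1.symm fun h => h2 (by rw [h, Prod.swap_swap]), mul_zero]
  rw [Matrix.mul_apply]
  split_ifs with h
  · refine Finset.sum_eq_single j (fun m _ hm => h0 m hm ?_) (by simp)
    rwa [show j.swap = j from Prod.ext h.symm h]
  · exact Finset.sum_eq_add j j.swap (fun hi => h (congrArg Prod.fst hi))
      (fun m _ hm => h0 m hm.1 hm.2) (by simp) (by simp)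

lemma commutant_reflU (hX : ∀ V : U d, kronSelf V * X = X * kronSelf V) {l k : Fin d}
    (h : l ≠ k) (i j : Fin d × Fin d) :
    (if j.1 = j.2 then kronSelf (reflU l k h) i j * X j j
      else kronSelf (reflU l k h) i j * X j j + kronSelf (reflU l k h) i j.swap * X j.swap j) =
    if i.1 = i.2 then X i i * kronSelf (reflU l k h) i j
      else X i i * kronSelf (reflU l k h) i j + X i i.swap * kronSelf (reflU l k h) i.swap j := by
  rw [← commutant_mul_apply hX, ← commutant_apply_mul hX, hX]

/-- Compare one entry of the two products with the reflection: every surviving coefficient is `(3/5)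
* (-4/5) = -12/25`, and dividing by it gives the relation. -/
lemma commutant_diag (hX : ∀ V : U d, kronSelf V * X = X * kronSelf V) {l k : Fin d}
    (h : l ≠ k) : X (l, l) (l, l) = X (l, k) (l, k) + X (l, k) (k, l) := by
  have := commutant_reflU hX h (l, k) (l, l)
  simp only [kronSelf, reflU, reflVec, Matrix.kroneckerMap_apply, Matrix.of_apply, h, h.symm,
    if_true, if_false, Prod.swap_prod_mk] at this
  linear_combination (-25 / 12 : ℂ) * this

lemma commutant_diag' (hX : ∀ V : U d, kronSelf V * X = X * kronSelf V) {l k : Fin d}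
    (h : l ≠ k) : X (l, l) (l, l) = X (l, k) (l, k) + X (k, l) (l, k) := by
  have := commutant_reflU hX h (l, l) (l, k)
  simp only [kronSelf, reflU, reflVec, Matrix.kroneckerMap_apply, Matrix.of_apply, h, h.symm,
    if_true, if_false, Prod.swap_prod_mk] at this
  linear_combination (25 / 12 : ℂ) * this

lemma commutant_diag_eq (hX : ∀ V : U d, kronSelf V * X = X * kronSelf V) {l k : Fin d}
    (h : l ≠ k) : X (l, l) (l, l) = X (k, k) (k, k) := by
  have := commutant_reflU hX h (l, k) (k, k)
  simp only [kronSelf, reflU, reflVec, Matrix.kroneckerMap_apply, Matrix.of_apply, h, h.symm,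
    if_true, if_false, Prod.swap_prod_mk] at this
  rw [commutant_diag hX h]
  linear_combination (-25 / 12 : ℂ) * this

/-- The reflection fixes `e_m`, so the compared entry carries only the coefficient `-4/5` that mixes
`l` with `k`. -/
lemma commutant_offdiag_left (hX : ∀ V : U d, kronSelf V * X = X * kronSelf V) {l k m : Fin d}
    (hl : l ≠ m) (hk : k ≠ m) : X (l, m) (l, m) = X (k, m) (k, m) := by
  by_cases h : l = k
  · rw [h]
  have := commutant_reflU hX h (l, m) (k, m)
  simp only [kronSelf, reflU, reflVec, Matrix.kroneckerMap_apply, Matrix.of_apply, h, Ne.symm h,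
    hl, hk, hl.symm, hk.symm, if_true, if_false, Prod.swap_prod_mk] at this
  linear_combination (5 / 4 : ℂ) * this

/-- Both sides differ from the common diagonal value by the same entry `X (l, k) (k, l)`. -/
lemma commutant_offdiag_symm (hX : ∀ V : U d, kronSelf V * X = X * kronSelf V) {l k : Fin d}
    (h : l ≠ k) : X (l, k) (l, k) = X (k, l) (k, l) := by
  linear_combination commutant_diag_eq hX h - commutant_diag hX h + commutant_diag' hX h.symm

lemma commutant_offdiag_eq (hX : ∀ V : U d, kronSelf V * X = X * kronSelf V) {a b c e : Fin d}
    (hab : a ≠ b) (hce : c ≠ e) : X (a, b) (a, b) = X (c, e) (c, e) := by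
  by_cases h : c = b
  · subst h
    rw [commutant_offdiag_symm hX hab, commutant_offdiag_symm hX hab.symm,
      commutant_offdiag_symm hX hab, commutant_offdiag_symm hX hce]
    rw [commutant_offdiag_symm hX hab.symm]
    exact commutant_offdiag_left hX hab hce.symm
  · rw [commutant_offdiag_left hX hab h, commutant_offdiag_symm hX h,
      commutant_offdiag_left hX (Ne.symm h) hce.symm, commutant_offdiag_symm hX hce]

/-- An operator that commutes with all `V ⊗ V` is a combination of the identity and the swap. -/
theorem commutant_eq (hd : 2 ≤ d) (hX : ∀ V : U d, kronSelf V * X = X * kronSelf V) :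
    ∃ a b : ℂ, X = a • (1 : BiMat d) + b • swapMat d := by
  obtain ⟨x, y, hxy⟩ : ∃ x y : Fin d, x ≠ y := ⟨⟨0, by omega⟩, ⟨1, by omega⟩, by simp⟩
  -- The identity coefficient is an off-diagonal-pair entry; by `commutant_diag` the swap
  -- coefficient is `X (x, y) (y, x)`.
  refine ⟨X (x, y) (x, y), X (x, x) (x, x) - X (x, y) (x, y), ?_⟩
  ext ⟨i1, i2⟩ j
  simp only [Matrix.add_apply, Matrix.smul_apply, smul_eq_mul, Matrix.one_apply, swapMat,
    Matrix.of_apply, Prod.swap_prod_mk]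
  have hdiag : ∀ i, X (i, i) (i, i) = X (x, x) (x, x) := by
    intro i
    by_cases h : i = x
    · rw [h]
    · exact commutant_diag_eq hX h
  by_cases h1 : j = (i1, i2)
  · subst h1
    by_cases h : i1 = i2
    · subst h; simp [hdiag]
    · simp [h, Ne.symm h, commutant_offdiag_eq hX h hxy]
  · by_cases h2 : j = (i2, i1)
    · subst h2
      have h : i1 ≠ i2 := fun h => h1 (by rw [h])
      simp only [Prod.mk.injEq, h, Ne.symm h, and_self, if_false, if_true]
      rw [← hdiag i1, ← commutant_offdiag_eq hX h hxy, commutant_diag hX h]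
      ring
    · rw [commutant_support hX h1 h2, if_neg (Ne.symm h1), if_neg (Ne.symm h2)]
      simp

end Commutant

/-! ### Compact convex hulls and the Haar twirl -/

/-- In finite dimension the convex hull of a compact set is compact. -/
lemma isCompact_convexHull {E : Type*} [NormedAddCommGroup E] [NormedSpace ℝ E]
    [FiniteDimensional ℝ E] {s : Set E} (hs : IsCompact s) : IsCompact (convexHull ℝ s) := by
  rcases s.eq_empty_or_nonempty with rfl | ⟨x₀, hx₀⟩
  · simp
  -- Carathéodory: `N` points suffice, so the hull is the continuous image of a simplex times `s ^
  -- N`. Shorter combinations are padded with weight zero at `x₀`.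
  set N := Module.finrank ℝ E + 1
  have hK : IsCompact (stdSimplex ℝ (Fin N) ×ˢ Set.univ.pi fun _ : Fin N => s) :=
    (isCompact_stdSimplex ℝ (Fin N)).prod (isCompact_univ_pi fun _ => hs)
  have hc : Continuous fun p : (Fin N → ℝ) × (Fin N → E) => ∑ i, p.1 i • p.2 i := by fun_prop
  convert hK.image hc using 1
  refine Set.Subset.antisymm (fun x hx => ?_) ?_
  · obtain ⟨ι, _, z, w, hz, hind, hw, hw1, hx⟩ := eq_pos_convex_span_of_mem_convexHull hx
    have hcard : Fintype.card ι ≤ Fintype.card (Fin N) := by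
      rw [Fintype.card_fin]
      exact hind.card_le_finrank_succ.trans (Nat.succ_le_succ (Submodule.finrank_le _))
    obtain ⟨e⟩ := Function.Embedding.nonempty_of_card_le hcard
    have hext : ∀ j ∉ Set.range e, Function.extend e w 0 j = 0 := fun j hj =>
      Function.extend_apply' _ _ _ hj
    refine ⟨(Function.extend e w 0, Function.extend e z fun _ => x₀), ⟨⟨fun j => ?_, ?_⟩, ?_⟩, ?_⟩
    · by_cases hj : j ∈ Set.range e
      · obtain ⟨i, rfl⟩ := hj
        simp only [e.injective.extend_apply]
        exact (hw i).le
      · simp only [hext j hj, le_refl]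
    · rw [← hw1]
      exact (Fintype.sum_of_injective e e.injective _ _ hext
        fun i => (e.injective.extend_apply _ _ _).symm).symm
    · intro j _
      by_cases hj : j ∈ Set.range e
      · obtain ⟨i, rfl⟩ := hj
        simp only [e.injective.extend_apply]
        exact hz ⟨i, rfl⟩
      · simp only [Function.extend_apply' _ _ _ hj]
        exact hx₀
    · rw [← hx]
      refine (Fintype.sum_of_injective e e.injective _ _ (fun j hj => ?_) fun i => ?_).symm
      · simp only [hext j hj, zero_smul]
      · simp only [e.injective.extend_apply]
  · rintro _ ⟨⟨w, z⟩, ⟨hw, hz⟩, rfl⟩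
    exact mem_convexHull_of_exists_fintype w z hw.1 hw.2 (fun i => hz i trivial) rfl

section Twirl

variable {d : ℕ}

instance : MeasureTheory.IsProbabilityMeasure (haarU d) :=
  ⟨by simpa [haarU] using MeasureTheory.Measure.haarMeasure_self (G := U d) (K₀ := ⊤)⟩

instance : (haarU d).IsMulLeftInvariant :=
  inferInstanceAs (MeasureTheory.Measure.haarMeasure _).IsMulLeftInvariant

lemma continuous_kronSelf : Continuous (kronSelf : U d → BiMat d) := by
  refine continuous_matrix fun i j => ?_
  have h : ∀ a b, Continuous fun V : U d => (V : Matrix (Fin d) (Fin d) ℂ) a b :=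
    fun a b => continuous_subtype_val.matrix_elem a b
  exact (h _ _).mul (h _ _)

lemma continuous_conj (ρ : BiMat d) :
    Continuous fun V : U d => kronSelf V * ρ * (kronSelf V)ᴴ :=
  (continuous_kronSelf.matrix_mul continuous_const).matrix_mul
    continuous_kronSelf.matrix_conjTranspose

lemma integrable_conj_apply (ρ : BiMat d) (i j : Fin d × Fin d) :
    MeasureTheory.Integrable (fun V : U d => (kronSelf V * ρ * (kronSelf V)ᴴ) i j) (haarU d) :=
  ((continuous_conj ρ).matrix_elem i j).integrable_of_hasCompactSupport
    (HasCompactSupport.of_compactSpace _)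

lemma twirl_apply (ρ : BiMat d) (i j : Fin d × Fin d) :
    twirl ρ i j = ∫ V, (kronSelf V * ρ * (kronSelf V)ᴴ) i j ∂haarU d := rfl

lemma map_twirl (L : BiMat d →ₗ[ℂ] ℂ) (ρ : BiMat d) :
    L (twirl ρ) = ∫ V, L (kronSelf V * ρ * (kronSelf V)ᴴ) ∂haarU d := by
  have e : ∀ M : BiMat d, L M = ∑ i, ∑ j, M i j * L (Matrix.single i j 1) := by
    intro M
    conv_lhs => rw [Matrix.matrix_eq_sum_single M]
    simp only [map_sum]
    refine Finset.sum_congr rfl fun i _ => Finset.sum_congr rfl fun j _ => ?_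
    rw [← smul_eq_mul, ← map_smul, Matrix.smul_single, smul_eq_mul, mul_one]
  have hi : ∀ i j, MeasureTheory.Integrable (fun V : U d =>
      (kronSelf V * ρ * (kronSelf V)ᴴ) i j * L (Matrix.single i j 1)) (haarU d) :=
    fun i j => (integrable_conj_apply ρ i j).mul_const _
  rw [e]
  simp_rw [e (_ * ρ * _)]
  rw [MeasureTheory.integral_finsetSum _ fun i _ =>
    MeasureTheory.integrable_finsetSum _ fun j _ => hi i j]
  refine Finset.sum_congr rfl fun i _ => ?_
  rw [MeasureTheory.integral_finsetSum _ fun j _ => hi i j]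
  refine Finset.sum_congr rfl fun j _ => ?_
  rw [MeasureTheory.integral_mul_const, twirl_apply]

/-- Conjugating by `W` translates the integration variable on the left, and Haar measure is left
invariant. -/
lemma kronSelf_conj_twirl (W : U d) (ρ : BiMat d) :
    kronSelf W * twirl ρ * (kronSelf W)ᴴ = twirl ρ := by
  ext i j
  have h := map_twirl (Matrix.entryLinearMap ℂ ℂ i j ∘ₗ LinearMap.mulRight ℂ (kronSelf W)ᴴ ∘ₗ
    LinearMap.mulLeft ℂ (kronSelf W)) ρ
  simp only [LinearMap.comp_apply, LinearMap.mulLeft_apply, LinearMap.mulRight_apply,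
    Matrix.entryLinearMap_apply] at h
  rw [h, twirl_apply,
    ← MeasureTheory.integral_mul_left_eq_self
      (fun V => (kronSelf V * ρ * (kronSelf V)ᴴ) i j) W]
  simp only [kronSelf_mul, Matrix.conjTranspose_mul, Matrix.mul_assoc]

lemma twirl_commutes (ρ : BiMat d) (W : U d) : kronSelf W * twirl ρ = twirl ρ * kronSelf W := by
  conv_rhs => rw [← kronSelf_conj_twirl W ρ, Matrix.mul_assoc, kronSelf_star_mul, Matrix.mul_one]

/-- By cyclicity of the trace the integrand is constant. It is needed for `M = 1` and for the swap,
the two functionals that determine a twirled operator. -/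
lemma trace_mul_twirl {M : BiMat d} (hM : ∀ V : U d, M * kronSelf V = kronSelf V * M)
    (ρ : BiMat d) : (M * twirl ρ).trace = (M * ρ).trace := by
  have h := map_twirl (Matrix.traceLinearMap _ ℂ ℂ ∘ₗ LinearMap.mulLeft ℂ M) ρ
  simp only [LinearMap.comp_apply, LinearMap.mulLeft_apply, Matrix.traceLinearMap_apply] at h
  rw [h]
  have e : ∀ V : U d, (M * (kronSelf V * ρ * (kronSelf V)ᴴ)).trace = (M * ρ).trace := by
    intro V
    rw [← Matrix.mul_assoc, ← Matrix.mul_assoc, hM, Matrix.trace_mul_comm, ← Matrix.mul_assoc,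
      ← Matrix.mul_assoc, kronSelf_star_mul, Matrix.one_mul]
  simp [e]

lemma trace_twirl (ρ : BiMat d) : (twirl ρ).trace = ρ.trace := by
  simpa using trace_mul_twirl (M := 1) (fun V => by simp) ρ

lemma trace_swapMat_mul_twirl (ρ : BiMat d) :
    (swapMat d * twirl ρ).trace = (swapMat d * ρ).trace :=
  trace_mul_twirl (fun _ => swapMat_mul_kronecker _) ρ

/-- The weight of an operator of trace one on the antisymmetric subspace. -/
def antiWeight (ρ : BiMat d) : ℝ := (1 - (swapMat d * ρ).trace.re) / 2

/-- The two traces form a linear system in the coefficients with determinant `d² (d² - 1)`, nonzero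
for `d ≥ 2`. -/
lemma eq_of_trace_eq (hd : 2 ≤ d) {a b a' b' : ℂ}
    (h1 : (a • (1 : BiMat d) + b • swapMat d).trace = (a' • (1 : BiMat d) + b' • swapMat d).trace)
    (h2 : (swapMat d * (a • (1 : BiMat d) + b • swapMat d)).trace =
      (swapMat d * (a' • (1 : BiMat d) + b' • swapMat d)).trace) :
    a • (1 : BiMat d) + b • swapMat d = a' • (1 : BiMat d) + b' • swapMat d := by
  have hd0 : (d : ℂ) ≠ 0 := by exact_mod_cast (by omega : d ≠ 0)
  have hd1 : (d : ℂ) - 1 ≠ 0 := sub_ne_zero.2 (by exact_mod_cast (by omega : d ≠ 1))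
  have hd2 : (d : ℂ) + 1 ≠ 0 := by exact_mod_cast (by omega : d + 1 ≠ 0)
  simp only [Matrix.mul_add, Matrix.mul_smul, swapMat_mul_self, Matrix.mul_one, Matrix.trace_add,
    Matrix.trace_smul, Matrix.trace_one, trace_swapMat, Fintype.card_prod, Fintype.card_fin,
    smul_eq_mul, Nat.cast_mul] at h1 h2
  have ha : a = a' := by
    have : (d : ℂ) * (d - 1) * (d + 1) * (a - a') = 0 := by linear_combination d * h1 - h2
    simpa [hd0, hd1, hd2, sub_eq_zero] using this
  have hb : b = b' := by
    have : (d : ℂ) * (d - 1) * (d + 1) * (b - b') = 0 := by linear_combination d * h2 - h1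
    simpa [hd0, hd1, hd2, sub_eq_zero] using this
  rw [ha, hb]

lemma werner_eq_one_swap (d : ℕ) (w : ℝ) :
    werner d w = (((1 - w) / (d * (d + 1)) + w / (d * (d - 1)) : ℝ) : ℂ) • (1 : BiMat d) +
      (((1 - w) / (d * (d + 1)) - w / (d * (d - 1)) : ℝ) : ℂ) • swapMat d := by
  rw [werner_eq]
  push_cast
  module

lemma trace_werner (hd : 2 ≤ d) (w : ℝ) : (werner d w).trace = 1 := by
  have hd0 : (d : ℂ) ≠ 0 := by exact_mod_cast (by omega : d ≠ 0)
  have hd1 : (d : ℂ) - 1 ≠ 0 := sub_ne_zero.2 (by exact_mod_cast (by omega : d ≠ 1))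
  have hd2 : (d : ℂ) + 1 ≠ 0 := by exact_mod_cast (by omega : d + 1 ≠ 0)
  rw [werner_eq_one_swap]
  simp only [Matrix.trace_add, Matrix.trace_smul, Matrix.trace_one, trace_swapMat,
    Fintype.card_prod, Fintype.card_fin, smul_eq_mul, Nat.cast_mul]
  push_cast
  field_simp
  ring

lemma trace_swapMat_mul_werner (hd : 2 ≤ d) (w : ℝ) :
    (swapMat d * werner d w).trace = ((1 - 2 * w : ℝ) : ℂ) := by
  have hd0 : (d : ℂ) ≠ 0 := by exact_mod_cast (by omega : d ≠ 0)
  have hd1 : (d : ℂ) - 1 ≠ 0 := sub_ne_zero.2 (by exact_mod_cast (by omega : d ≠ 1))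
  have hd2 : (d : ℂ) + 1 ≠ 0 := by exact_mod_cast (by omega : d + 1 ≠ 0)
  rw [werner_eq_one_swap]
  simp only [Matrix.mul_add, Matrix.mul_smul, swapMat_mul_self, Matrix.mul_one, Matrix.trace_add,
    Matrix.trace_smul, Matrix.trace_one, trace_swapMat, Fintype.card_prod, Fintype.card_fin,
    smul_eq_mul, Nat.cast_mul]
  push_cast
  field_simp
  ring

lemma antiWeight_werner (hd : 2 ≤ d) (w : ℝ) : antiWeight (werner d w) = w := by
  rw [antiWeight, trace_swapMat_mul_werner hd, Complex.ofReal_re]; ring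

lemma trace_swapMat_mul_im {ρ : BiMat d} (h : ρ.IsHermitian) : (swapMat d * ρ).trace.im = 0 := by
  have : star (swapMat d * ρ).trace = (swapMat d * ρ).trace := by
    rw [← Matrix.trace_conjTranspose, Matrix.conjTranspose_mul, h.eq, (swapMat_isHermitian d).eq,
      Matrix.trace_mul_comm]
  exact Complex.conj_eq_iff_im.1 this

/-- The twirl of a Hermitian operator of trace one is the Werner state with the same weight on the
antisymmetric subspace. -/
theorem twirl_eq_werner (hd : 2 ≤ d) {ρ : BiMat d} (hρ : ρ.IsHermitian) (h1 : ρ.trace = 1) :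
    twirl ρ = werner d (antiWeight ρ) := by
  obtain ⟨a, b, hab⟩ := commutant_eq hd (twirl_commutes ρ)
  have e1 : (twirl ρ).trace = (werner d (antiWeight ρ)).trace := by
    rw [trace_twirl, h1, trace_werner hd]
  have e2 : (swapMat d * twirl ρ).trace = (swapMat d * werner d (antiWeight ρ)).trace := by
    rw [trace_swapMat_mul_twirl, trace_swapMat_mul_werner hd]
    apply Complex.ext
    · rw [Complex.ofReal_re, antiWeight]; ring
    · rw [Complex.ofReal_im, trace_swapMat_mul_im hρ]
  rw [hab, werner_eq_one_swap] at e1 e2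
  rw [hab, werner_eq_one_swap]
  exact eq_of_trace_eq hd e1 e2

lemma werner_injective (hd : 2 ≤ d) : Function.Injective (werner d) := fun x y h => by
  rw [← antiWeight_werner hd x, h, antiWeight_werner hd]

lemma antiWeight_mem {ρ : BiMat d} (hρ : IsState ρ) :
    antiWeight ρ ∈ Set.Icc (0 : ℝ) 1 := by
  -- With `s = ±1` the operator `1 + s F` is self-adjoint with square `2 (1 + s F)`, so positivity
  -- of `ρ` gives `0 ≤ 1 + s tr (F ρ)`.
  have key : ∀ s : ℂ, star s = s → s * s = 1 → 0 ≤ 1 + s.re * (swapMat d * ρ).trace.re := by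
    intro s hs hs2
    have hs' : s.im = 0 := Complex.conj_eq_iff_im.1 hs
    have hP : ((1 + s • swapMat d) * ρ * (1 + s • swapMat d)ᴴ).PosSemidef :=
      hρ.1.mul_mul_conjTranspose_same _
    have ht := hP.trace_nonneg
    have e : (1 + s • swapMat d)ᴴ * (1 + s • swapMat d) = (2 : ℂ) • (1 + s • swapMat d) := by
      rw [Matrix.conjTranspose_add, Matrix.conjTranspose_smul, (swapMat_isHermitian d).eq, hs,
        Matrix.conjTranspose_one]
      simp only [Matrix.add_mul, Matrix.mul_add, Matrix.one_mul, Matrix.mul_one, Matrix.smul_mul,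
        Matrix.mul_smul, swapMat_mul_self]
      linear_combination (norm := module) hs2 • (1 : BiMat d)
    rw [Matrix.trace_mul_cycle, e, Matrix.smul_mul, Matrix.add_mul, Matrix.one_mul,
      Matrix.smul_mul, Matrix.trace_smul, Matrix.trace_add, Matrix.trace_smul, hρ.2] at ht
    have := (Complex.le_def.1 ht).1
    simp [hs'] at this
    linarith
  have h1 := key 1 (by simp) (by simp)
  have h2 := key (-1) (by simp) (by simp)
  simp only [Complex.one_re, Complex.neg_re] at h1 h2
  constructor <;> rw [antiWeight] <;> linarith

lemma antiWeight_ketBra (φ : BiVec d) : antiWeight (ketBra φ) = (1 - swapExp φ) / 2 := by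
  rw [antiWeight, trace_swapMat_mul_ketBra]

lemma twirl_ketBra (hd : 2 ≤ d) {φ : BiVec d} (hφ : ‖φ‖ = 1) :
    twirl (ketBra φ) = werner d ((1 - swapExp φ) / 2) := by
  rw [twirl_eq_werner hd (isState_ketBra hφ).1.isHermitian (isState_ketBra hφ).2,
    antiWeight_ketBra]

lemma swapExp_rotVec (V : U d) (φ : BiVec d) : swapExp (rotVec V V φ) = swapExp φ := by
  rw [← trace_swapMat_mul_ketBra, ← trace_swapMat_mul_ketBra, ketBra_rotVec, ← Matrix.mul_assoc,
    ← Matrix.mul_assoc, swapMat_mul_kronecker, Matrix.trace_mul_comm, ← Matrix.mul_assoc,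
    ← Matrix.mul_assoc]
  have := kronSelf_star_mul V
  rw [kronSelf] at this
  rw [this, Matrix.one_mul]

/-- The twirl of a pure state is a finite mixture of rotated copies of it. -/
lemma exists_finite_twirl (φ : BiVec d) :
    ∃ (n : ℕ) (p : Fin n → ℝ) (V : Fin n → U d), (∀ i, 0 ≤ p i) ∧ ∑ i, p i = 1 ∧
      ∑ i, (p i : ℂ) • ketBra (rotVec (V i) (V i) φ) = twirl (ketBra φ) := by
  set f : U d → Fin d × Fin d → Fin d × Fin d → ℂ :=
    fun V i j => (kronSelf V * ketBra φ * (kronSelf V)ᴴ) i j with hf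
  have hcont : Continuous f := continuous_pi fun i => continuous_pi fun j =>
    (continuous_conj _).matrix_elem i j
  have hint : MeasureTheory.Integrable f (haarU d) :=
    hcont.integrable_of_hasCompactSupport (HasCompactSupport.of_compactSpace _)
  -- The Haar mean lies in every closed convex set containing the orbit. Compactness makes the hull
  -- itself closed, so the mean is exactly a finite mixture, as the convex roof requires.
  have hK : IsCompact (convexHull ℝ (Set.range f)) :=
    isCompact_convexHull (isCompact_range hcont)
  have hI : ∫ V, f V ∂haarU d = fun i j => twirl (ketBra φ) i j := by
    ext i j
    exact (((ContinuousLinearMap.proj (R := ℝ) j).comp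
      (ContinuousLinearMap.proj (R := ℝ) (φ := fun _ : Fin d × Fin d => Fin d × Fin d → ℂ)
        i)).integral_comp_comm hint).symm
  have hm : (fun i j => twirl (ketBra φ) i j) ∈ convexHull ℝ (Set.range f) := by
    rw [← hI]
    exact (convex_convexHull ℝ _).integral_mem hK.isClosed
      (Filter.Eventually.of_forall fun V => subset_convexHull ℝ _ ⟨V, rfl⟩) hint
  obtain ⟨ι, _, p, z, hp, hp1, hz, hs⟩ := mem_convexHull_iff_exists_fintype.1 hm
  choose V hV using hz
  let e := (Fintype.equivFin ι).symm
  refine ⟨Fintype.card ι, p ∘ e, V ∘ e, fun i => hp _, ?_, ?_⟩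
  · rw [← hp1]; exact e.sum_comp p
  · refine (e.sum_comp fun i => (p i : ℂ) • ketBra (rotVec (V i) (V i) φ)).trans ?_
    ext a b
    rw [← congrFun (congrFun hs a) b]
    simp only [Matrix.sum_apply, Finset.sum_apply, Pi.smul_apply]
    refine Finset.sum_congr rfl fun i _ => ?_
    rw [← hV, ketBra_rotVec, Matrix.smul_apply]
    exact (Complex.real_smul).symm

end Twirl

/-! ### Least concurrence at a given swap expectation -/

section

variable {d : ℕ}

/-- With `α² ≤ x`, `β² ≤ 1 - x ≤ x` the quantity `2αβ + (1 - x) - β²` is at most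
`2 √(x (1 - x))`. -/
lemma two_mul_mul_add_le {x α β : ℝ} (hx : x ∈ Set.Icc (1 / 2 : ℝ) 1) (hβ : 0 ≤ β)
    (h1 : α ^ 2 ≤ x) (h2 : β ^ 2 ≤ 1 - x) :
    2 * (α * β) + (1 - x - β ^ 2) ≤ 2 * √(x * (1 - x)) := by
  obtain ⟨hx1, hx2⟩ := hx
  rw [Real.sqrt_mul (by linarith)]
  have e1 : √x ^ 2 = x := Real.sq_sqrt (by linarith)
  have e2 : √(1 - x) ^ 2 = 1 - x := Real.sq_sqrt (by linarith)
  have a1 : α ≤ √x := Real.le_sqrt_of_sq_le h1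
  have b1 : β ≤ √(1 - x) := Real.le_sqrt_of_sq_le h2
  have c1 : √(1 - x) ≤ √x := Real.sqrt_le_sqrt (by linarith)
  -- After replacing `α` by `√x`, the gap is `(√(1 - x) - β) (2 √x - √(1 - x) - β)`, with both
  -- factors nonnegative as `β ≤ √(1 - x) ≤ √x`.
  nlinarith [mul_le_mul_of_nonneg_right a1 hβ,
    mul_nonneg (sub_nonneg.2 b1) (by linarith : 0 ≤ 2 * √x - √(1 - x) - β)]

lemma neg_re_mul_star_le (a b : ℂ) : -(a * star b).re ≤ ‖a‖ * ‖b‖ := by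
  have := Complex.abs_re_le_norm (a * star b)
  rw [norm_mul, norm_star] at this
  linarith [neg_abs_le (a * star b).re]

/-- If the `m`-th row of the coefficient matrix has squared norm `x ≥ 1/2`, the swap expectation
is at least `-2 √(x (1 - x))`. -/
lemma neg_swapExp_le {φ : BiVec d} (hφ : ‖φ‖ = 1) (m : Fin d)
    (hx : 1 / 2 ≤ ∑ j, ‖coeffMat φ m j‖ ^ 2) :
    -swapExp φ ≤
      2 * √((∑ j, ‖coeffMat φ m j‖ ^ 2) * (1 - ∑ j, ‖coeffMat φ m j‖ ^ 2)) := by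
  set A := coeffMat φ with hA
  set x := ∑ j, ‖A m j‖ ^ 2 with hxdef
  set s := Finset.univ.erase m with hs
  have split : ∀ f : Fin d → ℝ, ∑ i, f i = f m + ∑ i ∈ s, f i := fun f =>
    (Finset.add_sum_erase _ f (Finset.mem_univ m)).symm
  have htot : x + ∑ i ∈ s, ∑ j, ‖A i j‖ ^ 2 = 1 := by
    rw [hxdef, ← split fun i => ∑ j, ‖A i j‖ ^ 2, ← norm_sq_eq_sum, hφ, one_pow]
  -- The matrix splits into the corner `(m, m)`, the rest of row `m` (mass `r`), the rest of column
  -- `m` (mass `c`) and the remaining block (mass `D`).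
  set r := ∑ j ∈ s, ‖A m j‖ ^ 2 with hr
  set c := ∑ i ∈ s, ‖A i m‖ ^ 2 with hc
  set D := ∑ i ∈ s, ∑ j ∈ s, ‖A i j‖ ^ 2 with hD
  have hx' : x = ‖A m m‖ ^ 2 + r := split _
  have hcD : c + D = 1 - x := by
    rw [hc, hD, ← Finset.sum_add_distrib, ← htot, add_sub_cancel_left]
    exact Finset.sum_congr rfl fun i _ => (split fun j => ‖A i j‖ ^ 2).symm
  have hr0 : 0 ≤ r := Finset.sum_nonneg fun _ _ => sq_nonneg _
  have hc0 : 0 ≤ c := Finset.sum_nonneg fun _ _ => sq_nonneg _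
  have hD0 : 0 ≤ D := Finset.sum_nonneg fun _ _ => Finset.sum_nonneg fun _ _ => sq_nonneg _
  have hcs : ∑ j ∈ s, ‖A m j‖ * ‖A j m‖ ≤ √r * √c := by
    rw [← Real.sqrt_mul hr0]
    exact Real.le_sqrt_of_sq_le (Finset.sum_mul_sq_le_sq_mul_sq _ _ _)
  have hDD : ∑ i ∈ s, ∑ j ∈ s, ‖A i j‖ * ‖A j i‖ ≤ D := by
    have hsw : ∑ i ∈ s, ∑ j ∈ s, ‖A j i‖ ^ 2 = D := Finset.sum_comm
    have : ∑ i ∈ s, ∑ j ∈ s, ‖A i j‖ * ‖A j i‖ ≤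
        ∑ i ∈ s, ∑ j ∈ s, (‖A i j‖ ^ 2 / 2 + ‖A j i‖ ^ 2 / 2) :=
      Finset.sum_le_sum fun i _ => Finset.sum_le_sum fun j _ => by
        nlinarith [sq_nonneg (‖A i j‖ - ‖A j i‖)]
    simp only [Finset.sum_add_distrib, ← Finset.sum_div, hsw] at this
    linarith
  -- The corner contributes a nonpositive term, row against column is Cauchy–Schwarz counted twice,
  -- and the block is bounded by the arithmetic–geometric mean.
  have hE : -swapExp φ ≤ 2 * (√r * √c) + D := by
    have e : -swapExp φ = ∑ i, ∑ j, -(A i j * star (A j i)).re := by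
      simp only [swapExp, hA, Finset.sum_neg_distrib]
    have b1 : -(A m m * star (A m m)).re ≤ 0 := by
      have : A m m * star (A m m) = ((‖A m m‖ ^ 2 : ℝ) : ℂ) := by
        simp [Complex.mul_conj, Complex.normSq_eq_norm_sq]
      rw [this, Complex.ofReal_re]
      simp
    have b2 : ∑ j ∈ s, -(A m j * star (A j m)).re ≤ √r * √c :=
      (Finset.sum_le_sum fun j _ => neg_re_mul_star_le _ _).trans hcs
    have b3 : ∑ i ∈ s, ∑ j, -(A i j * star (A j i)).re ≤ √r * √c + D := by
      calc _ = ∑ i ∈ s, -(A i m * star (A m i)).re +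
            ∑ i ∈ s, ∑ j ∈ s, -(A i j * star (A j i)).re := by
            rw [← Finset.sum_add_distrib]
            exact Finset.sum_congr rfl fun i _ => split _
        _ ≤ ∑ i ∈ s, ‖A m i‖ * ‖A i m‖ + ∑ i ∈ s, ∑ j ∈ s, ‖A i j‖ * ‖A j i‖ := by
            refine add_le_add (Finset.sum_le_sum fun i _ => ?_)
              (Finset.sum_le_sum fun i _ => Finset.sum_le_sum fun j _ => neg_re_mul_star_le _ _)
            rw [mul_comm ‖A m i‖]
            exact neg_re_mul_star_le _ _
        _ ≤ _ := add_le_add hcs hDD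
    rw [e, split, split]
    linarith
  have hfin := two_mul_mul_add_le (x := x) (α := √r) (β := √c) ⟨hx, by linarith⟩
    (Real.sqrt_nonneg _)
    (by rw [Real.sq_sqrt hr0]; nlinarith [sq_nonneg ‖A m m‖])
    (by rw [Real.sq_sqrt hc0]; linarith)
  rw [Real.sq_sqrt hc0] at hfin
  linarith

/-- The lower bound for the total concurrence in terms of the swap expectation. -/
theorem wernerZeta_le_totalConcurrence {q w : ℝ} (hq : 2 ≤ q) (hw : w ∈ Set.Ioc (1 / 2 : ℝ) 1)
    {φ : BiVec d} (hφ : ‖φ‖ = 1) (hs : swapExp φ = 1 - 2 * w) :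
    wernerZeta q w ≤ totalConcurrence q φ := by
  obtain ⟨V, l, hl, hdiag⟩ := exists_rotVec_diagonal φ
  set ψ := rotVec V V φ
  have hψ : ‖ψ‖ = 1 := (norm_rotVec V V φ).trans hφ
  have hsψ : swapExp ψ = 1 - 2 * w := (swapExp_rotVec V φ).trans hs
  rw [← totalConcurrence_rotVec hq V V hφ, totalConcurrence_of_diagonal hq hψ hdiag, wernerZeta_eq]
  have hl0 : ∀ i, 0 ≤ l i := fun i => by
    rw [hl]; exact Finset.sum_nonneg fun _ _ => sq_nonneg _
  have hl1 : ∑ i, l i = 1 := by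
    simp only [hl]
    rw [← norm_sq_eq_sum, hψ, one_pow]
  have hle : ∀ i, l i ≤ 1 := fun i => by
    rw [← hl1]; exact Finset.single_le_sum (fun j _ => hl0 j) (Finset.mem_univ i)
  have hG0 : 0 ≤ √(w * (1 - w)) := Real.sqrt_nonneg _
  have hGsq : √(w * (1 - w)) ^ 2 = w * (1 - w) :=
    Real.sq_sqrt (mul_nonneg (by linarith [hw.1]) (by linarith [hw.2]))
  have hG1 : 2 * √(w * (1 - w)) ≤ 1 := by
    refine abs_le_of_sq_le_sq' (a := 2 * √(w * (1 - w))) ?_ zero_le_one |>.2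
    nlinarith [sq_nonneg (2 * w - 1)]
  by_cases hbig : ∃ m, 1 / 2 ≤ l m
  · obtain ⟨m, hm⟩ := hbig
    refine le_trans ?_ (two_mul_eigenTerm_le hq l hl0 hl1 m)
    refine mul_le_mul_of_nonneg_left ?_ zero_le_two
    have hb := neg_swapExp_le hψ m (by rw [← hl]; exact hm)
    rw [← hl, hsψ] at hb
    -- Squared, the swap bound reads `(2 w - 1)² + (2 l m - 1)² ≤ 1`, which is symmetric in `w` and
    -- `l m` and so yields `2 l m - 1 ≤ G`.
    have hb2 : (2 * w - 1) ^ 2 ≤ 4 * (l m * (1 - l m)) := by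
      have h0 : 0 ≤ l m * (1 - l m) := mul_nonneg (hl0 m) (by linarith [hle m])
      have := Real.sq_sqrt h0
      have h3 : 0 ≤ 2 * w - 1 := by linarith [hw.1]
      nlinarith [Real.sqrt_nonneg (l m * (1 - l m))]
    refine eigenTerm_antitoneOn hq ⟨hm, hle m⟩ ⟨by linarith, by linarith⟩ ?_
    have : (2 * l m - 1) ≤ 2 * √(w * (1 - w)) := by
      refine abs_le_of_sq_le_sq' (a := 2 * l m - 1) ?_ (by linarith) |>.2
      nlinarith
    linarith
  · push Not at hbig
    refine le_trans ?_ (two_mul_eigenTerm_half_le hq l (fun i => ⟨hl0 i, (hbig i).le⟩) hl1)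
    exact mul_le_mul_of_nonneg_left (eigenTerm_le_half hq ⟨by linarith, by linarith⟩) zero_le_two

lemma totalConcurrence_nonneg {q : ℝ} (hq : 2 ≤ q) {φ : BiVec d} (hφ : ‖φ‖ = 1) :
    0 ≤ totalConcurrence q φ := by
  obtain ⟨V, l, hl, hdiag⟩ := exists_rotVec_diagonal φ
  have hψ : ‖rotVec V V φ‖ = 1 := (norm_rotVec V V φ).trans hφ
  rw [← totalConcurrence_rotVec hq V V hφ, totalConcurrence_of_diagonal hq hψ hdiag]
  have hl0 : ∀ i, 0 ≤ l i := fun i => by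
    rw [hl]; exact Finset.sum_nonneg fun _ _ => sq_nonneg _
  have hl1 : ∑ i, l i = 1 := by
    simp only [hl]
    rw [← norm_sq_eq_sum, hψ, one_pow]
  exact Finset.sum_nonneg fun i _ => eigenTerm_nonneg hq ⟨hl0 i, by
    rw [← hl1]; exact Finset.single_le_sum (fun j _ => hl0 j) (Finset.mem_univ i)⟩

lemma exists_totalConcurrence_eq_wernerZeta (hd : 2 ≤ d) {q w : ℝ} (hq : 2 ≤ q)
    (hw : w ∈ Set.Ioc (1 / 2 : ℝ) 1) :
    ∃ φ : BiVec d, ‖φ‖ = 1 ∧ swapExp φ = 1 - 2 * w ∧ totalConcurrence q φ = wernerZeta q w := by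
  obtain ⟨x, y, hxy⟩ : ∃ x y : Fin d, x ≠ y := ⟨⟨0, by omega⟩, ⟨1, by omega⟩, by simp⟩
  set G := 2 * √(w * (1 - w)) with hG
  have hG0 : 0 ≤ G := by positivity
  have hGsq : G ^ 2 = 1 - (2 * w - 1) ^ 2 := by
    rw [hG, mul_pow, Real.sq_sqrt (mul_nonneg (by linarith [hw.1]) (by linarith [hw.2]))]; ring
  have hG1 : G ≤ 1 := by
    refine abs_le_of_sq_le_sq' (a := G) ?_ zero_le_one |>.2
    nlinarith [sq_nonneg (2 * w - 1)]
  set a := √((1 + G) / 2) with ha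
  set b := √((1 - G) / 2) with hb
  have ha2 : a ^ 2 = (1 + G) / 2 := Real.sq_sqrt (by linarith)
  have hb2 : b ^ 2 = (1 - G) / 2 := Real.sq_sqrt (by linarith)
  have hab : 2 * (a * b) = 2 * w - 1 := by
    refine (sq_eq_sq₀ (by positivity) (by linarith [hw.1])).1 ?_
    rw [mul_pow, mul_pow, ha2, hb2]; linarith
  -- The vector `a |xy⟩ - b |yx⟩` has Schmidt weights `(1 ± G) / 2` and swap expectation `-2 a b = 1
  -- - 2 w`.
  set A : Matrix (Fin d) (Fin d) ℂ :=
    Matrix.single x y (a : ℂ) + Matrix.single y x (-b : ℂ) with hA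
  set l : Fin d → ℝ := fun i => (if i = x then a ^ 2 else 0) + if i = y then b ^ 2 else 0 with hl
  have hAA : A * Aᴴ = Matrix.diagonal fun i => (l i : ℂ) := by
    have e : (Matrix.diagonal fun i => (l i : ℂ)) =
        Matrix.single x x ((a : ℂ) * a) + Matrix.single y y ((b : ℂ) * b) := by
      ext i j
      simp only [Matrix.diagonal_apply, Matrix.add_apply, Matrix.single_apply, hl]
      by_cases hij : i = j
      · subst hij
        simp [eq_comm (a := i), sq, apply_ite Complex.ofReal]
      · have h1 : ∀ z, ¬(z = i ∧ z = j) := fun z h => hij (h.1.symm.trans h.2)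
        simp [hij, h1]
    rw [e, hA]
    simp [Matrix.conjTranspose_single, Matrix.add_mul, Matrix.mul_add,
      Matrix.single_mul_single_of_ne, hxy, hxy.symm]
  have hn : ‖vecOf A‖ = 1 := by
    have h := trace_coeffMat_mul (vecOf A)
    rw [coeffMat_vecOf, hAA, Matrix.trace_diagonal] at h
    have h' : ∑ i, l i = ‖vecOf A‖ ^ 2 := by exact_mod_cast h
    simp only [hl, Finset.sum_add_distrib, Finset.sum_ite_eq', Finset.mem_univ, if_true] at h'
    have : ‖vecOf A‖ ^ 2 = 1 := by rw [← h']; linarith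
    exact (sq_eq_sq₀ (norm_nonneg _) zero_le_one).1 (by rw [this, one_pow])
  refine ⟨vecOf A, hn, ?_, ?_⟩
  · have e : ∀ i j, (A i j * star (A j i)).re = (if i = x then if j = y then -(a * b) else 0 else 0)
        + (if i = y then if j = x then -(a * b) else 0 else 0) := by
      intro i j
      by_cases h1 : i = x
      · subst h1
        by_cases h2 : j = y
        · subst h2; simp [hA, hxy, hxy.symm]
        · simp [hA, hxy, hxy.symm, h2, Ne.symm h2]
      · by_cases h3 : i = y
        · subst h3
          by_cases h2 : j = x
          · subst h2; simp [hA, hxy, hxy.symm, mul_comm]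
          · simp [hA, hxy, hxy.symm, h2, Ne.symm h2]
        · simp [hA, h1, h3, Ne.symm h1, Ne.symm h3]
    simp only [swapExp, coeffMat_vecOf, e, Finset.sum_add_distrib]
    simp
    linarith
  · rw [totalConcurrence_of_diagonal hq hn hAA, wernerZeta_eq,
      ← Finset.add_sum_erase _ _ (Finset.mem_univ x),
      ← Finset.add_sum_erase _ _ (Finset.mem_erase.2 ⟨hxy.symm, Finset.mem_univ y⟩),
      Finset.sum_eq_zero]
    · simp only [hl, hxy, hxy.symm, if_true, if_false, add_zero, zero_add, ha2, hb2]
      rw [show (1 - G) / 2 = 1 - (1 + G) / 2 by ring, eigenTerm_symm]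
      ring
    · intro i hi
      simp only [Finset.mem_erase] at hi
      simp [hl, hi.1, hi.2.1, eigenTerm_zero hq]

lemma exists_totalConcurrence_eq_zero (hd : 2 ≤ d) {q w : ℝ} (hq : 2 ≤ q)
    (hw : w ∈ Set.Icc (0 : ℝ) (1 / 2)) :
    ∃ φ : BiVec d, ‖φ‖ = 1 ∧ swapExp φ = 1 - 2 * w ∧ totalConcurrence q φ = 0 := by
  obtain ⟨x, y, hxy⟩ : ∃ x y : Fin d, x ≠ y := ⟨⟨0, by omega⟩, ⟨1, by omega⟩, by simp⟩
  set a := √(1 - 2 * w) with ha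
  set b := √(2 * w) with hb
  have ha2 : a * a = 1 - 2 * w := Real.mul_self_sqrt (by linarith [hw.2])
  have hb2 : b * b = 2 * w := Real.mul_self_sqrt (by linarith [hw.1])
  -- The product vector `|x⟩ ⊗ (a |x⟩ + b |y⟩)` has a pure reduced state and swap expectation `a² =
  -- 1 - 2 w`.
  set A : Matrix (Fin d) (Fin d) ℂ :=
    Matrix.single x x (a : ℂ) + Matrix.single x y (b : ℂ) with hA
  set l : Fin d → ℝ := fun i => if i = x then 1 else 0 with hl
  have hAA : A * Aᴴ = Matrix.diagonal fun i => (l i : ℂ) := by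
    have e : (Matrix.diagonal fun i => (l i : ℂ)) =
        Matrix.single x x ((a : ℂ) * a) + Matrix.single x x ((b : ℂ) * b) := by
      rw [← Matrix.single_add, ← Complex.ofReal_mul, ← Complex.ofReal_mul, ← Complex.ofReal_add,
        ha2, hb2]
      ext i j
      simp only [Matrix.diagonal_apply, Matrix.single_apply, hl]
      by_cases hij : i = j
      · subst hij
        simp [eq_comm (a := i), apply_ite Complex.ofReal]
      · have h1 : ∀ z, ¬(z = i ∧ z = j) := fun z h => hij (h.1.symm.trans h.2)
        simp [hij, h1]
    rw [e, hA]
    simp [Matrix.conjTranspose_single, Matrix.add_mul, Matrix.mul_add,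
      Matrix.single_mul_single_of_ne, hxy, hxy.symm]
  have hn : ‖vecOf A‖ = 1 := by
    have h := trace_coeffMat_mul (vecOf A)
    rw [coeffMat_vecOf, hAA, Matrix.trace_diagonal] at h
    have h' : ∑ i, l i = ‖vecOf A‖ ^ 2 := by exact_mod_cast h
    simp only [hl, Finset.sum_ite_eq', Finset.mem_univ, if_true] at h'
    exact (sq_eq_sq₀ (norm_nonneg _) zero_le_one).1 (by rw [← h', one_pow])
  refine ⟨vecOf A, hn, ?_, ?_⟩
  · have e : ∀ i j, (A i j * star (A j i)).re =
        if i = x then if j = x then 1 - 2 * w else 0 else 0 := by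
      intro i j
      by_cases h1 : i = x
      · subst h1
        by_cases h2 : j = i
        · subst h2; simp [hA, hxy.symm, ha2]
        · simp [hA, hxy.symm, h2, Ne.symm h2]
      · simp [hA, h1, Ne.symm h1]
    simp only [swapExp, coeffMat_vecOf, e]
    simp
  · rw [totalConcurrence_of_diagonal hq hn hAA]
    refine Finset.sum_eq_zero fun i _ => ?_
    by_cases h : i = x <;> simp [hl, h, eigenTerm_zero hq, eigenTerm_one hq]

end

/-! ### Convex roofs and convex hulls on the Werner states -/

section

variable {d : ℕ}

/-- The averages of `E` over the decompositions of `ρ` into pure states. -/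
def roofValues (E : BiVec d → ℝ) (ρ : BiMat d) : Set ℝ :=
  {x : ℝ | ∃ (n : ℕ) (p : Fin n → ℝ) (φ : Fin n → BiVec d),
    (∀ i, 0 ≤ p i) ∧ ∑ i, p i = 1 ∧ (∀ i, ‖φ i‖ = 1) ∧
    ∑ i, (p i : ℂ) • ketBra (φ i) = ρ ∧ x = ∑ i, p i * E (φ i)}

lemma convexRoof_eq (E : BiVec d → ℝ) (ρ : BiMat d) : convexRoof E ρ = sInf (roofValues E ρ) := rfl

lemma nonneg_of_mem_roofValues {E : BiVec d → ℝ} (hE : ∀ φ, ‖φ‖ = 1 → 0 ≤ E φ) {ρ : BiMat d}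
    {x : ℝ} (hx : x ∈ roofValues E ρ) : 0 ≤ x := by
  obtain ⟨n, p, φ, hp, -, hφ, -, rfl⟩ := hx
  exact Finset.sum_nonneg fun i _ => mul_nonneg (hp i) (hE _ (hφ i))

lemma bddBelow_roofValues {E : BiVec d → ℝ} (hE : ∀ φ, ‖φ‖ = 1 → 0 ≤ E φ) (ρ : BiMat d) :
    BddBelow (roofValues E ρ) := ⟨0, fun _ hx => nonneg_of_mem_roofValues hE hx⟩

lemma convexRoof_nonneg {E : BiVec d → ℝ} (hE : ∀ φ, ‖φ‖ = 1 → 0 ≤ E φ) (ρ : BiMat d) :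
    0 ≤ convexRoof E ρ :=
  Real.sInf_nonneg fun _ hx => nonneg_of_mem_roofValues hE hx

/-- Decompositions of `ρ` and `σ`, reweighted by `a` and `b`, are concatenated; this makes the roof
convex. -/
lemma add_mem_roofValues {E : BiVec d → ℝ} {ρ σ : BiMat d} {x y a b : ℝ}
    (hx : x ∈ roofValues E ρ) (hy : y ∈ roofValues E σ) (ha : 0 ≤ a) (hb : 0 ≤ b)
    (hab : a + b = 1) : a * x + b * y ∈ roofValues E (a • ρ + b • σ) := by
  obtain ⟨n, p, φ, hp, hp1, hφ, rfl, rfl⟩ := hx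
  obtain ⟨m, r, ψ, hr, hr1, hψ, rfl, rfl⟩ := hy
  refine ⟨n + m, Fin.append (fun i => a * p i) (fun i => b * r i), Fin.append φ ψ, ?_, ?_, ?_, ?_,
    ?_⟩
  · refine Fin.addCases (fun i => ?_) fun i => ?_
    · simpa using mul_nonneg ha (hp i)
    · simpa using mul_nonneg hb (hr i)
  · simp [Fin.sum_univ_add, ← Finset.mul_sum, hp1, hr1, hab]
  · refine Fin.addCases (fun i => ?_) fun i => ?_
    · simpa using hφ i
    · simpa using hψ i
  · simp only [Fin.sum_univ_add, Fin.append_left, Fin.append_right, Finset.smul_sum]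
    congr 1 <;> refine Finset.sum_congr rfl fun i _ => ?_
    · rw [Complex.ofReal_mul, mul_smul]; rfl
    · rw [Complex.ofReal_mul, mul_smul]; rfl
  · simp only [Fin.sum_univ_add, Fin.append_left, Fin.append_right, Finset.mul_sum, mul_assoc]

lemma convexRoof_add_le {E : BiVec d → ℝ} (hE : ∀ φ, ‖φ‖ = 1 → 0 ≤ E φ) {ρ σ : BiMat d} {a b : ℝ}
    (hρ : (roofValues E ρ).Nonempty) (hσ : (roofValues E σ).Nonempty) (ha : 0 ≤ a) (hb : 0 ≤ b)
    (hab : a + b = 1) : convexRoof E (a • ρ + b • σ) ≤ a * convexRoof E ρ + b * convexRoof E σ := by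
  refine le_of_forall_pos_le_add fun ε hε => ?_
  obtain ⟨x, hx, hx'⟩ := exists_lt_of_csInf_lt hρ (lt_add_of_pos_right (sInf (roofValues E ρ)) hε)
  obtain ⟨y, hy, hy'⟩ := exists_lt_of_csInf_lt hσ (lt_add_of_pos_right (sInf (roofValues E σ)) hε)
  have h := csInf_le (bddBelow_roofValues hE _) (add_mem_roofValues hx hy ha hb hab)
  simp only [convexRoof_eq]
  have e : a * ε + b * ε = ε := by rw [← add_mul, hab, one_mul]
  linarith [mul_le_mul_of_nonneg_left hx'.le ha, mul_le_mul_of_nonneg_left hy'.le hb]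

/-- The twirl decomposes into finitely many rotated copies of `φ`, and invariance gives each of them
the value `E φ`. -/
lemma mem_roofValues_twirl {E : BiVec d → ℝ}
    (hinv : ∀ (V : U d) (φ : BiVec d), ‖φ‖ = 1 → E (rotVec V V φ) = E φ) {φ : BiVec d}
    (hφ : ‖φ‖ = 1) : E φ ∈ roofValues E (twirl (ketBra φ)) := by
  obtain ⟨n, p, V, hp, hp1, hs⟩ := exists_finite_twirl φ
  refine ⟨n, p, fun i => rotVec (V i) (V i) φ, hp, hp1, fun i => by rw [norm_rotVec, hφ], hs, ?_⟩
  simp only [hinv _ _ hφ, ← Finset.sum_mul, hp1, one_mul]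

lemma swapExp_mem {φ : BiVec d} (hφ : ‖φ‖ = 1) : (1 - swapExp φ) / 2 ∈ Set.Icc (0 : ℝ) 1 := by
  rw [← antiWeight_ketBra]
  exact antiWeight_mem (isState_ketBra hφ)

/-- The antisymmetric weight of a mixture is the average of the weights. -/
lemma sum_weight_eq (hd : 2 ≤ d) {n : ℕ} {p : Fin n → ℝ} {φ : Fin n → BiVec d} {w : ℝ}
    (hp1 : ∑ i, p i = 1) (hs : ∑ i, (p i : ℂ) • ketBra (φ i) = werner d w) :
    ∑ i, p i * ((1 - swapExp (φ i)) / 2) = w := by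
  have h := antiWeight_werner hd w
  rw [← hs, antiWeight, Finset.mul_sum, Matrix.trace_sum, Complex.re_sum] at h
  simp only [Matrix.mul_smul, Matrix.trace_smul, smul_eq_mul, Complex.re_ofReal_mul,
    trace_swapMat_mul_ketBra] at h
  rw [← h, ← hp1, ← Finset.sum_sub_distrib, Finset.sum_div, hp1]
  exact Finset.sum_congr rfl fun i _ => by ring

lemma werner_combo (d : ℕ) {a b : ℝ} (hab : a + b = 1) (v w : ℝ) :
    werner d (a * v + b * w) = a • werner d v + b • werner d w := by
  have e : ∀ (r : ℝ) (M : BiMat d), r • M = (r : ℂ) • M := fun r M => rfl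
  have hb : (b : ℂ) = 1 - a := by
    rw [← Complex.ofReal_one, ← hab]; push_cast; ring
  simp only [werner_eq_one_swap, e]
  push_cast
  rw [hb]
  match_scalars <;> ring

/-- For a unitarily invariant nonnegative function `E` with a least value `f w` on the pure states
of antisymmetric weight `w`, the convex roof of `E` on Werner states is the convex hull of `f`. -/
theorem isConvexHullOn_convexRoof_werner (hd : 2 ≤ d) {E : BiVec d → ℝ}
    (hE : ∀ φ, ‖φ‖ = 1 → 0 ≤ E φ)
    (hinv : ∀ (V : U d) (φ : BiVec d), ‖φ‖ = 1 → E (rotVec V V φ) = E φ) {f : ℝ → ℝ}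
    (hf : ∀ w ∈ Set.Icc (0 : ℝ) 1, IsLeast (pureValues E (werner d w)) (f w)) :
    IsConvexHullOn (Set.Icc (0 : ℝ) 1) f (fun w => convexRoof E (werner d w)) := by
  have hmem : ∀ w ∈ Set.Icc (0 : ℝ) 1, f w ∈ roofValues E (werner d w) := by
    intro w hw
    obtain ⟨φ, hφ, ht, he⟩ := (hf w hw).1
    rw [← ht, he]
    exact mem_roofValues_twirl hinv hφ
  refine ⟨⟨convex_Icc _ _, fun v hv w hw a b ha hb hab => ?_⟩,
    fun w hw => csInf_le (bddBelow_roofValues hE _) (hmem w hw), fun k hk hkf w hw => ?_⟩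
  · simp only [smul_eq_mul]
    rw [werner_combo d hab]
    exact convexRoof_add_le hE ⟨_, hmem v hv⟩ ⟨_, hmem w hw⟩ ha hb hab
  · refine le_csInf ⟨_, hmem w hw⟩ ?_
    rintro _ ⟨n, p, φ, hp, hp1, hφ, hs, rfl⟩
    -- The weight `w` is the average of the weights of the pure terms, so Jensen applies to `k`.
    -- Each term is then bounded through the Werner state to which it twirls.
    rw [← sum_weight_eq hd hp1 hs]
    refine (hk.map_sum_le (fun i _ => hp i) hp1 fun i _ => swapExp_mem (hφ i)).trans ?_
    refine Finset.sum_le_sum fun i _ => mul_le_mul_of_nonneg_left ?_ (hp i)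
    exact (hkf _ (swapExp_mem (hφ i))).trans
      ((hf _ (swapExp_mem (hφ i))).2 ⟨φ i, hφ i, twirl_ketBra hd (hφ i), rfl⟩)

/-- A convex hull on the weights is a convex hull on the Werner states. -/
lemma IsConvexHullOn.of_werner {f g : BiMat d → ℝ}
    (h : IsConvexHullOn (Set.Icc (0 : ℝ) 1) (fun w => f (werner d w)) fun w => g (werner d w)) :
    IsConvexHullOn (werner d '' Set.Icc (0 : ℝ) 1) f g := by
  obtain ⟨h1, h2, h3⟩ := h
  refine ⟨⟨?_, ?_⟩, ?_, ?_⟩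
  · rintro _ ⟨v, hv, rfl⟩ _ ⟨w, hw, rfl⟩ a b ha hb hab
    exact ⟨a * v + b * w, convex_Icc _ _ hv hw ha hb hab, werner_combo d hab v w⟩
  · rintro _ ⟨v, hv, rfl⟩ _ ⟨w, hw, rfl⟩ a b ha hb hab
    rw [← werner_combo d hab]
    exact h1.2 hv hw ha hb hab
  · rintro _ ⟨w, hw, rfl⟩
    exact h2 w hw
  · rintro k hk hkf _ ⟨w, hw, rfl⟩
    refine h3 (fun w => k (werner d w)) ⟨convex_Icc _ _, fun v hv w hw a b ha hb hab => ?_⟩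
      (fun v hv => hkf _ ⟨v, hv, rfl⟩) w hw
    simp only [smul_eq_mul]
    rw [werner_combo d hab]
    exact hk.2 ⟨v, hv, rfl⟩ ⟨w, hw, rfl⟩ ha hb hab

lemma isLeast_pureValues_wernerZeta (hd : 2 ≤ d) {q w : ℝ} (hq : 2 ≤ q)
    (hw : w ∈ Set.Ioc (1 / 2 : ℝ) 1) :
    IsLeast (pureValues (totalConcurrence q) (werner d w)) (wernerZeta q w) := by
  constructor
  · obtain ⟨φ, hφ, hs, he⟩ := exists_totalConcurrence_eq_wernerZeta hd hq hw
    refine ⟨φ, hφ, ?_, he.symm⟩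
    rw [twirl_ketBra hd hφ, hs]
    congr 1; ring
  · rintro _ ⟨φ, hφ, ht, rfl⟩
    rw [twirl_ketBra hd hφ] at ht
    refine wernerZeta_le_totalConcurrence hq hw hφ ?_
    linarith [werner_injective hd ht]

lemma isLeast_pureValues_zero (hd : 2 ≤ d) {q w : ℝ} (hq : 2 ≤ q)
    (hw : w ∈ Set.Icc (0 : ℝ) (1 / 2)) :
    IsLeast (pureValues (totalConcurrence q) (werner d w)) 0 := by
  constructor
  · obtain ⟨φ, hφ, hs, he⟩ := exists_totalConcurrence_eq_zero hd hq hw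
    refine ⟨φ, hφ, ?_, he.symm⟩
    rw [twirl_ketBra hd hφ, hs]
    congr 1; ring
  · rintro _ ⟨φ, hφ, -, rfl⟩
    exact totalConcurrence_nonneg hq hφ

lemma isLeast_pureValues (hd : 2 ≤ d) {q w : ℝ} (hq : 2 ≤ q) (hw : w ∈ Set.Icc (0 : ℝ) 1) :
    IsLeast (pureValues (totalConcurrence q) (werner d w))
      (if w ≤ 1 / 2 then 0 else wernerZeta q w) := by
  split_ifs with h
  · exact isLeast_pureValues_zero hd hq ⟨hw.1, h⟩
  · exact isLeast_pureValues_wernerZeta hd hq ⟨not_le.1 h, hw.2⟩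

lemma twirledStates_eq (hd : 2 ≤ d) : twirledStates d = werner d '' Set.Icc (0 : ℝ) 1 := by
  refine Set.Subset.antisymm ?_ ?_
  · rintro _ ⟨ρ, hρ, rfl⟩
    exact ⟨antiWeight ρ, antiWeight_mem hρ, (twirl_eq_werner hd hρ.1.isHermitian hρ.2).symm⟩
  · rintro _ ⟨w, hw, rfl⟩
    -- Only a pure state with the right twirl is wanted, so `le_rfl` fixes the arbitrary choice `q =
    -- 2`.
    obtain ⟨φ, hφ, ht, -⟩ := (isLeast_pureValues hd le_rfl hw).1
    exact ⟨ketBra φ, isState_ketBra hφ, ht⟩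

lemma isConvexHullOn_normConcurrence (hd : 2 ≤ d) {q : ℝ} (hq : 2 ≤ q) :
    IsConvexHullOn (Set.Icc (0 : ℝ) 1)
      (fun w => (1 / normFactor d q) * (if w ≤ 1 / 2 then 0 else wernerZeta q w))
      (fun w => normConcurrence q (werner d w)) := by
  have hμ : 0 ≤ 1 / normFactor d q := (one_div_pos.2 (normFactor_pos hd hq)).le
  refine isConvexHullOn_convexRoof_werner hd
    (fun φ hφ => mul_nonneg hμ (totalConcurrence_nonneg hq hφ))
    (fun V φ hφ => congrArg (_ * ·) (totalConcurrence_rotVec hq V V hφ))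
    fun w hw => ?_
  obtain ⟨⟨φ, hφ, ht, he⟩, hle⟩ := isLeast_pureValues hd hq hw
  refine ⟨⟨φ, hφ, ht, congrArg (_ * ·) he⟩, ?_⟩
  rintro _ ⟨ψ, hψ, ht', rfl⟩
  exact mul_le_mul_of_nonneg_left (hle ⟨ψ, hψ, ht', rfl⟩) hμ

lemma IsConvexHullOn.congr {X : Type*} [AddCommGroup X] [Module ℝ X] {s : Set X} {f f' g : X → ℝ}
    (h : IsConvexHullOn s f g) (hf : ∀ x ∈ s, f x = f' x) : IsConvexHullOn s f' g :=
  ⟨h.1, fun x hx => (h.2.1 x hx).trans (hf x hx).le,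
    fun k hk hkf => h.2.2 k hk fun x hx => (hkf x hx).trans (hf x hx).ge⟩

lemma symmetryReduced_eq (hd : 2 ≤ d) {q w : ℝ} (hq : 2 ≤ q) (hw : w ∈ Set.Icc (0 : ℝ) 1) :
    symmetryReduced (totalConcurrence q) (werner d w) =
      if w ≤ 1 / 2 then 0 else wernerZeta q w :=
  (isLeast_pureValues hd hq hw).csInf_eq

lemma normConcurrence_nonneg (hd : 2 ≤ d) {q : ℝ} (hq : 2 ≤ q) (ρ : BiMat d) :
    0 ≤ normConcurrence q ρ :=
  convexRoof_nonneg (fun _ hφ => mul_nonneg (one_div_pos.2 (normFactor_pos hd hq)).le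
    (totalConcurrence_nonneg hq hφ)) ρ

lemma wernerZeta_three {w : ℝ} (hw : w ∈ Set.Icc (0 : ℝ) 1) :
    wernerZeta 3 w = 3 / 2 * (2 * w - 1) ^ 2 := by
  have h := Real.sq_sqrt (mul_nonneg hw.1 (sub_nonneg.2 hw.2))
  have e : ∀ x : ℝ, x ^ (3 : ℝ) = x ^ 3 := fun x => by exact_mod_cast Real.rpow_natCast x 3
  rw [wernerZeta, e, e]
  linear_combination (-6 : ℝ) * h

lemma normFactor_two_three : normFactor 2 3 = 3 / 2 := by
  rw [normFactor_eq le_rfl, eigenTerm]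
  have e : ∀ x : ℝ, x ^ (3 : ℝ) = x ^ 3 := fun x => by exact_mod_cast Real.rpow_natCast x 3
  rw [e, e]
  norm_num

/-- For `d = 2` and `q = 3` the reduced function is `max (2 w - 1) 0 ^ 2`, which is already convex
and hence its own convex hull. -/
lemma normConcurrence_three_werner {w : ℝ} (hw : w ∈ Set.Ioc (1 / 2 : ℝ) 1) :
    normConcurrence 3 (werner 2 w) = (2 * w - 1) ^ 2 := by
  obtain ⟨-, hle, hmax⟩ := isConvexHullOn_normConcurrence (le_refl 2) (q := 3) (by norm_num)
  have hw' : w ∈ Set.Icc (0 : ℝ) 1 := ⟨by linarith [hw.1], hw.2⟩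
  have hval : ∀ v ∈ Set.Icc (0 : ℝ) 1, (1 / normFactor 2 3) *
      (if v ≤ 1 / 2 then 0 else wernerZeta 3 v) = max (2 * v - 1) 0 ^ 2 := by
    intro v hv
    rw [normFactor_two_three, wernerZeta_three hv]
    split_ifs with h
    · rw [max_eq_right (by linarith)]; norm_num
    · rw [max_eq_left (by linarith)]; ring
  have hconv : ConvexOn ℝ (Set.Icc (0 : ℝ) 1) fun v => max (2 * v - 1) 0 ^ 2 := by
    refine ConvexOn.pow ?_ (fun v _ => le_max_right _ _) 2
    refine ConvexOn.sup ⟨convex_Icc _ _, fun x _ y _ a b _ _ hab => ?_⟩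
      (convexOn_const _ (convex_Icc _ _))
    simp only [smul_eq_mul]
    exact le_of_eq (by linear_combination hab)
  have e : max (2 * w - 1) 0 = 2 * w - 1 := max_eq_left (by linarith [hw.1])
  refine le_antisymm ?_ ?_
  · have := hle w hw'
    simp only [hval w hw', e] at this
    exact this
  · have := hmax _ hconv (fun v hv => (hval v hv).ge) w hw'
    rwa [e] at this

end

end WernerState

end

/-! ### The main theorem -/

theorem mainTheorem7 :
    (∀ (d : ℕ), 2 ≤ d → ∀ (q : ℝ), 2 ≤ q →
      (∀ w ∈ Set.Ioc (1 / 2 : ℝ) 1,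
        IsLeast (WernerState.pureValues (WernerState.totalConcurrence q) (WernerState.werner d w))
          (WernerState.symmetryReduced (WernerState.totalConcurrence q) (WernerState.werner d w)) ∧
        WernerState.symmetryReduced (WernerState.totalConcurrence q) (WernerState.werner d w)
          = WernerState.wernerZeta q w) ∧
      (∀ w ∈ Set.Icc (0 : ℝ) (1 / 2),
        IsLeast (WernerState.pureValues (WernerState.totalConcurrence q) (WernerState.werner d w))
          (WernerState.symmetryReduced (WernerState.totalConcurrence q) (WernerState.werner d w)) ∧
        WernerState.symmetryReduced (WernerState.totalConcurrence q) (WernerState.werner d w)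
          = 0) ∧
      WernerState.twirledStates d = WernerState.werner d '' Set.Icc (0 : ℝ) 1 ∧
      WernerState.IsConvexHullOn (WernerState.twirledStates d)
        (fun ρ => (1 / WernerState.normFactor d q) *
          WernerState.symmetryReduced (WernerState.totalConcurrence q) ρ)
        (fun ρ => WernerState.normConcurrence q ρ) ∧
      WernerState.IsConvexHullOn (Set.Icc (0 : ℝ) 1)
        (fun w => (1 / WernerState.normFactor d q) *
          (if w ≤ 1 / 2 then 0 else WernerState.wernerZeta q w))
        (fun w => WernerState.normConcurrence q (WernerState.werner d w)) ∧
      (∀ w ∈ Set.Icc (0 : ℝ) (1 / 2),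
        WernerState.normConcurrence q (WernerState.werner d w) = 0)) ∧
    (∀ w ∈ Set.Ioc (1 / 2 : ℝ) 1,
      WernerState.normConcurrence 3 (WernerState.werner 2 w) = (2 * w - 1) ^ 2) := by
  refine ⟨fun d hd q hq => ?_, fun w hw => WernerState.normConcurrence_three_werner hw⟩
  have hhull := WernerState.isConvexHullOn_normConcurrence hd hq
  refine ⟨fun w hw => ?_, fun w hw => ?_, WernerState.twirledStates_eq hd, ?_, hhull,
    fun w hw => ?_⟩
  · have h := WernerState.isLeast_pureValues_wernerZeta hd hq hw
    have e : WernerState.symmetryReduced _ _ = _ := h.csInf_eq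
    exact ⟨by rwa [e], e⟩
  · have h := WernerState.isLeast_pureValues_zero hd hq hw
    have e : WernerState.symmetryReduced _ _ = _ := h.csInf_eq
    exact ⟨by rwa [e], e⟩
  · rw [WernerState.twirledStates_eq hd]
    refine WernerState.IsConvexHullOn.of_werner (hhull.congr fun w hw => ?_)
    rw [WernerState.symmetryReduced_eq hd hq hw]
  -- The hull lies below the reduced function, which vanishes here, and the roof is nonnegative.
  · refine le_antisymm ((hhull.2.1 w ⟨hw.1, by linarith [hw.2]⟩).trans_eq ?_)
      (WernerState.normConcurrence_nonneg hd hq _)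
    simp only [if_pos hw.2, mul_zero]
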